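/- An \emph{interlacing of $p$ lines} is a set of $p$ pairwise skew (disjoint and non-parallel) lines in $\mathbb R^3$. An \emph{isotopy} is a continuous motion of the lines during which they stay pairwise skew. An interlacing is \emph{amphicheiral} if it is isotopic to its mirror image, and \emph{nonamphicheiral} otherwise. The linking number of two oriented skew lines, through $a$ with direction $v$ and through $b$ with direction $w$, is the sign of $\det(v,w,a-b)$. The linking number of a triple of pairwise skew lines is the product of the linking numbers of its three pairs for any choice of orientations of the lines. For $\varepsilon=\pm1$, $\langle\varepsilon p\rangle$ denotes the isotopy type of $p$ generatrices of a one-sheeted hyperboloid, taken from the family in which every triple has linking number $\varepsilon$. To \emph{replace} the lines $X_i$ of an interlacing by $\langle\varepsilon_i n_i\rangle$ means to take one-sheeted hyperboloids with axes $X_i$ (axes up to an affine transformation) that bound pairwise disjoint regions around their axes, and to choose on the $i$-th one $n_i$ generatrices from the family of sign $\varepsilon_i$, so that the result is an interlacing. $\langle\langle+m\rangle,\langle-m\rangle\rangle$ denotes the isotopy type of an interlacing obtained from a pair of skew lines by replacing one line by $\langle+m\rangle$ and the other by $\langle-m\rangle$. The \emph{five-line example} consists of the lines joining $(i,0,0)$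 to $(0,\sigma(i),1)$ for $i=1,\dots,5$, where $\sigma(1),\dots,\sigma(5)=1,3,5,2,4$. Its first pair consists of the lines $i=3,4$, its second pair of the lines $i=2,5$, and its fifth line is the line $i=1$. 1. For every $p\ge3$, interlacings of type $\langle+p\rangle$ exist; every such interlacing consists of $p$ lines, all its triples have linking number $+1$, and it is nonamphicheiral. 2. A nonamphicheiral interlacing of $p$ lines exists if and only if $p\ge3$. 3. For every even $p\ge0$, interlacings of type $\langle\langle+p/2\rangle,\langle-p/2\rangle\rangle$ exist, and every one of them is an amphicheiral interlacing of $p$ lines. 4. Let $k\ge0$ and $\delta=\pm1$. Take an interlacing isotopic to the five-line example, with its lines labelled accordingly; replace both lines of the first pair by $\langle\delta k\rangle$ and both lines of the second pair by $\langle-\delta k\rangle$, and keep the fifth line as a single line (that is, replace it by one generatrix of a hyperboloid around it). Such interlacings exist, and every interlacing isotopic to one of them is an amphicheiral interlacing of $4k+1$ lines. 5. An amphicheiral interlacing of $p$ lines ($p\ge0$) exists if and only if $p\not\equiv3\pmod 4$. -/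

import Mathlib

/-- Euclidean three-dimensional space, with its standard (right-handed) orientation. -/
abbrev Space : Type := EuclideanSpace ℝ (Fin 3)

/-- The affine subspace through `a` with direction spanned by `v`; it is a line when `v ≠ 0`. -/
noncomputable def lineThrough (a v : Space) : AffineSubspace ℝ Space :=
  AffineSubspace.mk' a (Submodule.span ℝ {v})

/-- `L` is a straight line in space. -/
def IsLine (L : AffineSubspace ℝ Space) : Prop :=
  Module.finrank ℝ L.direction = 1

/-- Two lines are skew if they neither meet nor are parallel. -/
def Skew (L M : AffineSubspace ℝ Space) : Prop :=
  Disjoint (L : Set Space) (M : Set Space) ∧ ¬ L.Parallel M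

/-- An interlacing of `p` lines: a set of `p` pairwise skew lines. -/
def IsInterlacing (p : ℕ) (S : Set (AffineSubspace ℝ Space)) : Prop :=
  S.encard = p ∧ (∀ L ∈ S, IsLine L) ∧ S.Pairwise Skew

/-- An isotopy of labelled lines from `L` to `M`: a motion of the lines, continuous in time, during
which they stay pairwise skew. The `i`-th line at time `t` passes through `a i t` in the
direction of `v i t`. -/
def IsotopicFamilies {ι : Type} (L M : ι → AffineSubspace ℝ Space) : Prop :=
  ∃ a v : ι → unitInterval → Space,
    (∀ i, Continuous (a i)) ∧ (∀ i, Continuous (v i)) ∧ (∀ i t, v i t ≠ 0) ∧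
    (∀ t i j, i ≠ j → Skew (lineThrough (a i t) (v i t)) (lineThrough (a j t) (v j t))) ∧
    (∀ i, lineThrough (a i 0) (v i 0) = L i) ∧ (∀ i, lineThrough (a i 1) (v i 1) = M i)

/-- Isotopy of (unlabelled, finite) sets of pairwise skew lines. -/
def Isotopic (S T : Set (AffineSubspace ℝ Space)) : Prop :=
  ∃ (n : ℕ) (L M : Fin n → AffineSubspace ℝ Space),
    Set.range L = S ∧ Set.range M = T ∧ IsotopicFamilies L M

/-- The reflection of space in the plane orthogonal to the third coordinate axis. -/
noncomputable def mirror : Space ≃ₗᵢ[ℝ] Space :=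
  (Submodule.span ℝ {(EuclideanSpace.single 2 1 : Space)})ᗮ.reflection

/-- The mirror image of a set of lines. -/
noncomputable def mirrorImage (S : Set (AffineSubspace ℝ Space)) :
    Set (AffineSubspace ℝ Space) :=
  (fun L => L.map mirror.toLinearEquiv.toLinearMap.toAffineMap) '' S

/-- A set of lines is amphicheiral if it is isotopic to its mirror image. -/
def Amphicheiral (S : Set (AffineSubspace ℝ Space)) : Prop :=
  Isotopic S (mirrorImage S)

/-- The linking number of two oriented skew lines, the first through `a` directed by `v` and the
second through `b` directed by `w`. It is `+1` if the first line runs around the second one in the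
direction of the fingers of a right hand whose thumb points along the second line, and `-1`
otherwise. For example it is `+1` for the line through `(1,0,0)` directed by `(0,1,0)` and the
third coordinate axis directed upwards. -/
noncomputable def linkingNumber (a v b w : Space) : ℤ :=
  ((SignType.sign (Matrix.of ![v.ofLp, w.ofLp, (a - b).ofLp]).det : SignType) : ℤ)

/-- The (unoriented) triple of pairwise skew lines `L`, `M`, `N` has linking number `e`: for
every choice of orientations, `e` is the product of the three pairwise linking numbers. -/
def TripleHasLinkingNumber (L M N : AffineSubspace ℝ Space) (e : ℤ) : Prop :=
  ∀ a u b v c w : Space, u ≠ 0 → v ≠ 0 → w ≠ 0 →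
    lineThrough a u = L → lineThrough b v = M → lineThrough c w = N →
    linkingNumber a u b v * linkingNumber a u c w * linkingNumber b v c w = e

/-- The third coordinate axis, which is the axis of the standard one-sheeted hyperboloid. -/
noncomputable def axis : AffineSubspace ℝ Space :=
  lineThrough 0 (EuclideanSpace.single 2 1)

/-- The (closed) region that the standard one-sheeted hyperboloid `x² + y² = 1 + z²` bounds around
its axis. -/
def solidHyperboloid : Set Space :=
  {x | x 0 ^ 2 + x 1 ^ 2 ≤ 1 + x 2 ^ 2}

/-- The generatrix through `(cos θ, sin θ, 0)` of the standard one-sheeted hyperboloid, in the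
family with sign `ε`. Any three generatrices of that family have linking number `ε`. -/
noncomputable def generatrix (ε : ℤˣ) (θ : Real.Angle) : AffineSubspace ℝ Space :=
  lineThrough !₂[θ.cos, θ.sin, 0]
    !₂[-(((ε : ℤ) : ℝ) * θ.sin), ((ε : ℤ) : ℝ) * θ.cos, 1]

/-- An affine automorphism of space that preserves the orientation. Every one-sheeted hyperboloid is
the image of the standard one under such a map, and these maps preserve linking numbers. -/
def OrientationPreserving (g : Space ≃ᵃ[ℝ] Space) : Prop :=
  0 < LinearMap.det (g.linear : Space →ₗ[ℝ] Space)

/-- `S` consists of `n` generatrices of the family with sign `ε` on the hyperboloid that is the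
image of the standard one under `g`. -/
def IsGeneratrixSet (g : Space ≃ᵃ[ℝ] Space) (ε : ℤˣ) (n : ℕ)
    (S : Set (AffineSubspace ℝ Space)) : Prop :=
  ∃ θ : Fin n ↪ Real.Angle,
    S = Set.range fun j => (generatrix ε (θ j)).map (g : Space →ᵃ[ℝ] Space)

/-- `S` is obtained from the labelled interlacing `X` by replacing, for every `i`, the line `X i` by
`n i` generatrices of the family with sign `ε i` on a one-sheeted hyperboloid with axis `X i`,
where the hyperboloids bound pairwise disjoint regions around their axes. -/
def IsReplacement {ι : Type} (X : ι → AffineSubspace ℝ Space) (ε : ι → ℤˣ) (n : ι → ℕ)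
    (S : Set (AffineSubspace ℝ Space)) : Prop :=
  ∃ (g : ι → (Space ≃ᵃ[ℝ] Space)) (A : ι → Set (AffineSubspace ℝ Space)),
    (∀ i, OrientationPreserving (g i)) ∧
    (∀ i, axis.map (g i : Space →ᵃ[ℝ] Space) = X i) ∧
    (∀ i j, i ≠ j → Disjoint (g i '' solidHyperboloid) (g j '' solidHyperboloid)) ∧
    (∀ i, IsGeneratrixSet (g i) (ε i) (n i) (A i)) ∧
    S = ⋃ i, A i

/-- `S` is an interlacing of type `⟨ε p⟩`: up to isotopy, `p` generatrices of the family with sign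
`ε` on a one-sheeted hyperboloid. -/
def IsHyperboloidal (ε : ℤˣ) (p : ℕ) (S : Set (AffineSubspace ℝ Space)) : Prop :=
  ∃ (g : Space ≃ᵃ[ℝ] Space) (T : Set (AffineSubspace ℝ Space)),
    OrientationPreserving g ∧ IsGeneratrixSet g ε p T ∧ Isotopic S T

/-- `S` is an interlacing of type `⟨⟨+m⟩, ⟨-m⟩⟩`: up to isotopy, the two lines of a skew pair are
replaced by `⟨+m⟩` and by `⟨-m⟩`. -/
def IsDoubleHyperboloidal (m : ℕ) (S : Set (AffineSubspace ℝ Space)) : Prop :=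
  ∃ (X : Fin 2 → AffineSubspace ℝ Space) (T : Set (AffineSubspace ℝ Space)),
    (∀ i, IsLine (X i)) ∧ Skew (X 0) (X 1) ∧
    IsReplacement X ![1, -1] ![m, m] T ∧ Isotopic S T

/-- The line that joins the point with coordinate `i` on one of two fixed skew lines to the point with
coordinate `j` on the other one. -/
noncomputable def join (i j : ℝ) : AffineSubspace ℝ Space :=
  lineThrough !₂[i, 0, 0] (!₂[0, j, 1] - !₂[i, 0, 0])

/-- The five-line example, labelled. It joins the points `1, 2, 3, 4, 5` of one line to the points
`1, 3, 5, 2, 4` of another one, in this order. The lines with labels `0, 1` and those with labels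
`2, 3` are the two pairs: these four lines form an interlacing `⟨⟨+2⟩, ⟨-2⟩⟩`. The line with
label `4` is the fifth line, which separates the two lines of each pair. -/
noncomputable def fiveLines : Fin 5 → AffineSubspace ℝ Space :=
  ![join 3 5, join 4 2, join 2 3, join 5 4, join 1 1]

/-- `S` is obtained, up to isotopy, from the five-line example by replacing both lines of the
first pair by `⟨δ k⟩` and both lines of the second pair by the mirror type `⟨-δ k⟩`, while the
fifth line is kept as one line. -/
def IsFiveLineReplacement (δ : ℤˣ) (k : ℕ) (S : Set (AffineSubspace ℝ Space)) : Prop :=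
  ∃ (X : Fin 5 → AffineSubspace ℝ Space) (T : Set (AffineSubspace ℝ Space)),
    IsotopicFamilies fiveLines X ∧
    IsReplacement X ![δ, δ, -δ, -δ, 1] ![k, k, k, k, 1] T ∧ Isotopic S T

/-!
A line is given by a point and a direction, and two lines through `a`, `b` with directions `v`, `w`
are skew exactly when `det (v, w, a - b) ≠ 0` (`skew_lineThrough_iff`). An isotopy is therefore a
path in a space `Config` of families with nonvanishing determinants. The signs of the determinants,
which are the linking numbers, are constant along such a path (`sign_pairDet_eq`).

*Obstructions.* The linking number of a triple does not depend on orientations and changes its sign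
under reflections. All triples of `⟨+p⟩` have linking number `+1`, and the triples of its mirror
image have linking number `-1`; so `⟨+p⟩` is nonamphicheiral for `p ≥ 3`. For `p` odd, the product
of the linking numbers of all pairs does not depend on the orientations; a reflection multiplies it
by `(-1) ^ (p (p - 1) / 2)`, which is `-1` for `p ≡ 3 (mod 4)` (`not_amphicheiral_of_mod_four`).

*Replacements are well defined.* The hyperboloids of a replacement can be shrunk towards their axes
(`IsReplacement.exists_thinSet`): the lines stay in disjoint regions, so that they do not meet, and
a line whose direction lies inside the asymptotic cone of a hyperboloid cannot be parallel to a line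
disjoint from its region. A thin hyperboloid is given by a positively oriented frame along its axis.
A motion of the axes extends to a motion of frames, because the frames along a fixed line form a
connected set (`FrameConfig.joinedIn_of_core_joinedIn`); by compactness, generatrices close enough
to the axes remain skew along the motion. The angles of the generatrices can be interpolated when
listed in increasing order. Hence the isotopy type of a replacement depends only on the isotopy type
of the axes, the signs and the numbers of generatrices (`isotopic_thinSet`), and a single generatrix
has no sign.

*Amphicheirality.* A reflection changes the signs of the families of generatrices. So a replacement
is amphicheiral when the axes admit an isotopy to their mirror image that interchanges the lines of
opposite signs (`IsReplacement.amphicheiral`). Any two labelled pairs of skew lines are isotopic,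
which gives `⟨⟨+m⟩, ⟨-m⟩⟩`. For the five-line example, a cyclic turn of both parameters of the
joining lines leads to the parameters `(2, -1)`, `(-2, 1)`, `(1, 2)`, `(-1, -2)`, `(0, 0)`, a set
that is invariant under the orientation reversing substitution `(x, y) ↦ (-y, x)`
(`isotopicFamilies_fiveLines`).
-/

section

open Set Topology

variable {ι : Type}

/-! ### Lines, skewness and determinants -/

/-- The oriented volume `det (u, v, w)` of three vectors. -/
noncomputable def vol (u v w : Space) : ℝ :=
  (Matrix.of ![u.ofLp, v.ofLp, w.ofLp]).det

lemma vol_eq (u v w : Space) :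
    vol u v w = u 0 * (v 1 * w 2 - v 2 * w 1) - u 1 * (v 0 * w 2 - v 2 * w 0)
      + u 2 * (v 0 * w 1 - v 1 * w 0) := by
  simp only [vol, Matrix.det_fin_three, Matrix.of_apply, Matrix.cons_val]
  ring

lemma continuous_vol : Continuous fun p : Space × Space × Space => vol p.1 p.2.1 p.2.2 := by
  simp only [vol_eq]
  fun_prop

lemma mem_lineThrough {a v x : Space} : x ∈ lineThrough a v ↔ ∃ t : ℝ, x = a + t • v := by
  rw [lineThrough, AffineSubspace.mem_mk', Submodule.mem_span_singleton]
  refine exists_congr fun t => ?_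
  rw [vsub_eq_sub, eq_sub_iff_add_eq, add_comm, eq_comm]

lemma direction_lineThrough (a v : Space) :
    (lineThrough a v).direction = Submodule.span ℝ {v} :=
  AffineSubspace.direction_mk' _ _

lemma isLine_lineThrough (a : Space) {v : Space} (hv : v ≠ 0) : IsLine (lineThrough a v) := by
  rw [IsLine, direction_lineThrough]
  exact finrank_span_singleton hv

lemma isLine_iff {L : AffineSubspace ℝ Space} :
    IsLine L ↔ ∃ a v, v ≠ 0 ∧ lineThrough a v = L := by
  constructor
  · intro h
    obtain ⟨v, hv, hspan⟩ := finrank_eq_one_iff'.1 h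
    have hne : (L : Set Space).Nonempty := by
      by_contra hL
      rw [Set.not_nonempty_iff_eq_empty, AffineSubspace.coe_eq_bot_iff] at hL
      rw [hL, IsLine, AffineSubspace.direction_bot, finrank_bot] at h
      exact zero_ne_one h
    obtain ⟨a, ha⟩ := hne
    refine ⟨a, v, by simpa using hv, ?_⟩
    have hspan' : Submodule.span ℝ {(v : Space)} = L.direction := ?_
    · rw [lineThrough, hspan', AffineSubspace.mk'_eq ha]
    apply le_antisymm
    · simp
    · intro w hw
      obtain ⟨c, hc⟩ := hspan ⟨w, hw⟩
      exact Submodule.mem_span_singleton.2 ⟨c, congrArg Subtype.val hc⟩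
  · rintro ⟨a, v, hv, rfl⟩
    exact isLine_lineThrough a hv

lemma lineThrough_eq_of_eq {a v b w : Space} {c d : ℝ} (hc : c ≠ 0)
    (hb : b = a + d • v) (hw : w = c • v) : lineThrough b w = lineThrough a v := by
  ext x
  simp only [mem_lineThrough, hb, hw]
  constructor
  · rintro ⟨t, rfl⟩
    exact ⟨d + t * c, by module⟩
  · rintro ⟨t, rfl⟩
    refine ⟨(t - d) / c, ?_⟩
    rw [smul_smul, div_mul_cancel₀ _ hc]
    module

lemma eq_of_lineThrough_eq {a v b w : Space} (hw : w ≠ 0)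
    (h : lineThrough b w = lineThrough a v) : ∃ c d : ℝ, c ≠ 0 ∧ b = a + d • v ∧ w = c • v := by
  have hb : b ∈ lineThrough a v := by
    rw [← h]; exact mem_lineThrough.2 ⟨0, by simp⟩
  obtain ⟨d, hd⟩ := mem_lineThrough.1 hb
  have hs : w ∈ Submodule.span ℝ {v} := by
    rw [← direction_lineThrough a, ← h, direction_lineThrough]
    exact Submodule.mem_span_singleton_self w
  obtain ⟨c, hc⟩ := Submodule.mem_span_singleton.1 hs
  refine ⟨c, d, ?_, hd, hc.symm⟩
  rintro rfl
  exact hw (by rw [← hc, zero_smul])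

lemma map_lineThrough (f : Space →ᵃ[ℝ] Space) (a v : Space) :
    (lineThrough a v).map f = lineThrough (f a) (f.linear v) := by
  rw [lineThrough, AffineSubspace.map_mk', Submodule.map_span, Set.image_singleton]
  rfl

lemma ne_zero_of_vol_ne_zero {u v w : Space} (h : vol u v w ≠ 0) : u ≠ 0 ∧ v ≠ 0 := by
  constructor <;> rintro rfl <;> simp [vol_eq] at h

/-- Vectors `v`, `w`, `a - b` are linearly dependent exactly when the lines through `a` and `b` with
directions `v` and `w` meet or are parallel. -/
lemma skew_lineThrough_iff {a v b w : Space} (hv : v ≠ 0) (hw : w ≠ 0) :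
    Skew (lineThrough a v) (lineThrough b w) ↔ vol v w (a - b) ≠ 0 := by
  constructor
  · rintro ⟨hd, hp⟩ h0
    obtain ⟨x, hx, hx0⟩ := Matrix.exists_vecMul_eq_zero_iff.2 h0
    have hsum : x 0 • v + x 1 • w + x 2 • (a - b) = 0 := by
      ext k
      have := congrFun hx0 k
      simpa [Matrix.vecMul, dotProduct, Fin.sum_univ_three] using this
    by_cases h2 : x 2 = 0
    · rw [h2, zero_smul, add_zero] at hsum
      have h1 : x 1 ≠ 0 := by
        intro h1
        rw [h1, zero_smul, add_zero, smul_eq_zero, or_iff_left hv] at hsum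
        exact hx (funext fun k => by fin_cases k <;> assumption)
      have hwv : w = (-(x 0 / x 1)) • v := by
        have : x 1 • w = (-x 0) • v := by
          rw [neg_smul]; exact eq_neg_of_add_eq_zero_right hsum
        rw [← neg_div, div_eq_inv_mul, mul_smul, ← this, smul_smul, inv_mul_cancel₀ h1, one_smul]
      have hc : -(x 0 / x 1) ≠ 0 := by
        intro hc; rw [hc, zero_smul] at hwv; exact hw hwv
      apply hp
      rw [AffineSubspace.parallel_iff_direction_eq_and_eq_bot_iff_eq_bot, direction_lineThrough,
        direction_lineThrough, hwv, Submodule.span_singleton_smul_eq (IsUnit.mk0 _ hc)]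
      refine ⟨rfl, ?_⟩
      have (a v : Space) : lineThrough a v ≠ ⊥ := by
        intro h
        have : a ∈ lineThrough a v := mem_lineThrough.2 ⟨0, by simp⟩
        rw [h] at this
        exact this
      simp [this]
    · refine Set.disjoint_left.1 hd (?_ : a + (x 0 / x 2) • v ∈ _) ?_
      · exact mem_lineThrough.2 ⟨_, rfl⟩
      · refine mem_lineThrough.2 ⟨-(x 1 / x 2), ?_⟩
        have h3 : (x 2)⁻¹ • (x 0 • v + x 1 • w + x 2 • (a - b)) = 0 := by rw [hsum, smul_zero]
        rw [smul_add, smul_add, smul_smul, smul_smul, smul_smul, inv_mul_cancel₀ h2,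
          one_smul, ← div_eq_inv_mul, ← div_eq_inv_mul] at h3
        rw [← sub_eq_zero, ← h3]
        module
  · intro h
    refine ⟨Set.disjoint_left.2 fun x hx hx' => h ?_, fun hp => h ?_⟩
    · obtain ⟨s, rfl⟩ := mem_lineThrough.1 hx
      obtain ⟨t, ht⟩ := mem_lineThrough.1 hx'
      have hab : a - b = t • w - s • v := by
        rw [sub_eq_sub_iff_add_eq_add, ht, add_comm]
      rw [hab, vol_eq]
      simp only [PiLp.sub_apply, PiLp.smul_apply, smul_eq_mul]
      ring
    · have hdir := hp.direction_eq
      rw [direction_lineThrough, direction_lineThrough] at hdir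
      have : w ∈ Submodule.span ℝ {v} := hdir ▸ Submodule.mem_span_singleton_self w
      obtain ⟨c, rfl⟩ := Submodule.mem_span_singleton.1 this
      rw [vol_eq]
      simp only [PiLp.sub_apply, PiLp.smul_apply, smul_eq_mul]
      ring

lemma Skew.symm {L M : AffineSubspace ℝ Space} (h : Skew L M) : Skew M L :=
  ⟨h.1.symm, fun hp => h.2 hp.symm⟩

lemma not_skew_self {a v : Space} : ¬ Skew (lineThrough a v) (lineThrough a v) :=
  fun h => h.2 (AffineSubspace.Parallel.refl _)

/-! ### Configurations of pointed directed lines -/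

/-- The line through the point `x.1` with direction `x.2`. -/
noncomputable def line (x : Space × Space) : AffineSubspace ℝ Space := lineThrough x.1 x.2

/-- The determinant whose sign is the linking number of two directed lines. -/
noncomputable def pairDet (x y : Space × Space) : ℝ := vol x.2 y.2 (x.1 - y.1)

lemma pairDet_comm (x y : Space × Space) : pairDet x y = pairDet y x := by
  simp only [pairDet, vol_eq, PiLp.sub_apply]
  ring

lemma continuous_pairDet :
    Continuous fun p : (Space × Space) × (Space × Space) => pairDet p.1 p.2 :=
  continuous_vol.comp (f := fun p : (Space × Space) × (Space × Space) =>
    (p.1.2, p.2.2, p.1.1 - p.2.1)) (by fun_prop)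

/-- The same line with another base point and another direction vector. -/
noncomputable def reparam (c d : ℝ) (x : Space × Space) : Space × Space := (x.1 + d • x.2, c • x.2)

lemma line_reparam {c : ℝ} (hc : c ≠ 0) (d : ℝ) (x : Space × Space) :
    line (reparam c d x) = line x :=
  lineThrough_eq_of_eq hc rfl rfl

lemma exists_reparam {x y : Space × Space} (hy : y.2 ≠ 0) (h : line y = line x) :
    ∃ c d : ℝ, c ≠ 0 ∧ y = reparam c d x := by
  obtain ⟨c, d, hc, h1, h2⟩ := eq_of_lineThrough_eq hy h
  exact ⟨c, d, hc, Prod.ext h1 h2⟩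

lemma pairDet_reparam (c d c' d' : ℝ) (x y : Space × Space) :
    pairDet (reparam c d x) (reparam c' d' y) = c * c' * pairDet x y := by
  simp only [pairDet, reparam, vol_eq, PiLp.sub_apply, PiLp.add_apply, PiLp.smul_apply,
    smul_eq_mul]
  ring

/-- Families of pointed directed lines that are pairwise skew. -/
def Config (ι : Type) : Set (ι → Space × Space) :=
  {x | (∀ i, (x i).2 ≠ 0) ∧ ∀ i j, i ≠ j → pairDet (x i) (x j) ≠ 0}

lemma skew_line_iff {x y : Space × Space} (hx : x.2 ≠ 0) (hy : y.2 ≠ 0) :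
    Skew (line x) (line y) ↔ pairDet x y ≠ 0 := skew_lineThrough_iff hx hy

variable {ι : Type}

lemma exists_config {L : ι → AffineSubspace ℝ Space} (h : ∀ i, IsLine (L i))
    (hs : ∀ i j, i ≠ j → Skew (L i) (L j)) : ∃ x ∈ Config ι, ∀ i, line (x i) = L i := by
  choose a v hv hL using fun i => isLine_iff.1 (h i)
  refine ⟨fun i => (a i, v i), ⟨hv, fun i j hij => ?_⟩, hL⟩
  rw [← skew_line_iff (hv i) (hv j)]
  have := hs i j hij
  rwa [← hL i, ← hL j] at this

lemma Config.skew {x : ι → Space × Space} (h : x ∈ Config ι) {i j : ι} (hij : i ≠ j) :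
    Skew (line (x i)) (line (x j)) :=
  (skew_line_iff (h.1 i) (h.1 j)).2 (h.2 i j hij)

lemma Config.injective {x : ι → Space × Space} (h : x ∈ Config ι) :
    Function.Injective fun i => line (x i) := by
  intro i j hij
  by_contra hne
  have := Config.skew h hne
  simp only at hij
  rw [hij] at this
  exact not_skew_self this

lemma Config.comp {κ : Type} {x : ι → Space × Space} (h : x ∈ Config ι) {f : κ → ι}
    (hf : Function.Injective f) : x ∘ f ∈ Config κ :=
  ⟨fun _ => h.1 _, fun _ _ hij => h.2 _ _ (hf.ne hij)⟩

lemma Config.reparam {x : ι → Space × Space} (h : x ∈ Config ι) {c : ι → ℝ} (d : ι → ℝ)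
    (hc : ∀ i, c i ≠ 0) : (fun i => reparam (c i) (d i) (x i)) ∈ Config ι := by
  refine ⟨fun i => smul_ne_zero (hc i) (h.1 i), fun i j hij => ?_⟩
  rw [pairDet_reparam]
  exact mul_ne_zero (mul_ne_zero (hc i) (hc j)) (h.2 i j hij)

lemma isotopicFamilies_iff {L M : ι → AffineSubspace ℝ Space} :
    IsotopicFamilies L M ↔ ∃ x y, JoinedIn (Config ι) x y ∧ (∀ i, line (x i) = L i) ∧
      ∀ i, line (y i) = M i := by
  constructor
  · rintro ⟨a, v, ha, hv, hv0, hs, hL, hM⟩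
    refine ⟨fun i => (a i 0, v i 0), fun i => (a i 1, v i 1),
      ⟨⟨⟨fun t i => (a i t, v i t), by fun_prop⟩, rfl, rfl⟩, fun t => ⟨fun i => hv0 i t, ?_⟩⟩,
      hL, hM⟩
    intro i j hij
    exact (skew_lineThrough_iff (hv0 i t) (hv0 j t)).1 (hs t i j hij)
  · rintro ⟨x, y, ⟨γ, hγ⟩, hL, hM⟩
    refine ⟨fun i t => (γ t i).1, fun i t => (γ t i).2, fun i => ?_, fun i => ?_,
      fun i t => (hγ t).1 i, fun t i j hij => Config.skew (hγ t) hij, fun i => ?_, fun i => ?_⟩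
    · fun_prop
    · fun_prop
    · rw [← hL i]; simp [line]
    · rw [← hM i]; simp [line]

/-- An isotopy can be started with any choice of base points and directions. -/
lemma IsotopicFamilies.lift {L M : ι → AffineSubspace ℝ Space} (h : IsotopicFamilies L M)
    {x : ι → Space × Space} (hx : ∀ i, (x i).2 ≠ 0) (hxL : ∀ i, line (x i) = L i) :
    ∃ y, JoinedIn (Config ι) x y ∧ ∀ i, line (y i) = M i := by
  obtain ⟨x', y', hj, hL, hM⟩ := isotopicFamilies_iff.1 h
  choose c d hc hxx using fun i => exists_reparam (hx i) ((hxL i).trans (hL i).symm)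
  refine ⟨fun i => reparam (c i) (d i) (y' i), ?_, fun i => by rw [line_reparam (hc i), hM]⟩
  obtain rfl : x = fun i => reparam (c i) (d i) (x' i) := funext hxx
  have hcont : Continuous fun (z : ι → Space × Space) i => reparam (c i) (d i) (z i) := by
    unfold reparam; fun_prop
  refine (hj.map hcont).mono ?_
  rintro _ ⟨z, hz, rfl⟩
  exact Config.reparam hz d hc

lemma isotopicFamilies_of_joinedIn {x y : ι → Space × Space} (h : JoinedIn (Config ι) x y) :
    IsotopicFamilies (fun i => line (x i)) fun i => line (y i) :=
  isotopicFamilies_iff.2 ⟨x, y, h, fun _ => rfl, fun _ => rfl⟩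

lemma IsotopicFamilies.symm {L M : ι → AffineSubspace ℝ Space} (h : IsotopicFamilies L M) :
    IsotopicFamilies M L := by
  obtain ⟨x, y, hj, hL, hM⟩ := isotopicFamilies_iff.1 h
  exact isotopicFamilies_iff.2 ⟨y, x, hj.symm, hM, hL⟩

lemma IsotopicFamilies.trans {L M N : ι → AffineSubspace ℝ Space} (h : IsotopicFamilies L M)
    (h' : IsotopicFamilies M N) : IsotopicFamilies L N := by
  obtain ⟨x, y, hj, hL, hM⟩ := isotopicFamilies_iff.1 h
  obtain ⟨z, hz, hN⟩ := h'.lift hj.target_mem.1 hM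
  exact isotopicFamilies_iff.2 ⟨x, z, hj.trans hz, hL, hN⟩

lemma IsotopicFamilies.comp {κ : Type} {L M : ι → AffineSubspace ℝ Space}
    (h : IsotopicFamilies L M) {f : κ → ι} (hf : Function.Injective f) :
    IsotopicFamilies (L ∘ f) (M ∘ f) := by
  obtain ⟨x, y, hj, hL, hM⟩ := isotopicFamilies_iff.1 h
  refine isotopicFamilies_iff.2 ⟨x ∘ f, y ∘ f, (hj.map (f := (· ∘ f)) (by fun_prop)).mono ?_,
    fun i => hL _, fun i => hM _⟩
  rintro _ ⟨z, hz, rfl⟩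
  exact Config.comp hz hf

lemma IsotopicFamilies.exists_config_left {L M : ι → AffineSubspace ℝ Space}
    (h : IsotopicFamilies L M) : ∃ x ∈ Config ι, ∀ i, line (x i) = L i := by
  obtain ⟨x, y, hj, hL, hM⟩ := isotopicFamilies_iff.1 h
  exact ⟨x, hj.source_mem, hL⟩

lemma isotopicFamilies_refl {L : ι → AffineSubspace ℝ Space} {x : ι → Space × Space}
    (hx : x ∈ Config ι) (hL : ∀ i, line (x i) = L i) : IsotopicFamilies L L :=
  isotopicFamilies_iff.2 ⟨x, x, JoinedIn.refl hx, hL, hL⟩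

lemma isotopic_range [Finite ι] {L M : ι → AffineSubspace ℝ Space} (h : IsotopicFamilies L M) :
    Isotopic (range L) (range M) := by
  obtain ⟨n, ⟨e⟩⟩ := Finite.exists_equiv_fin ι
  refine ⟨n, L ∘ e.symm, M ∘ e.symm, ?_, ?_, h.comp e.symm.injective⟩ <;>
    rw [EquivLike.range_comp]

lemma Isotopic.symm {S T : Set (AffineSubspace ℝ Space)} (h : Isotopic S T) : Isotopic T S := by
  obtain ⟨n, L, M, hL, hM, h⟩ := h
  exact ⟨n, M, L, hM, hL, h.symm⟩

lemma IsotopicFamilies.injective_left {L M : ι → AffineSubspace ℝ Space}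
    (h : IsotopicFamilies L M) : Function.Injective L := by
  obtain ⟨x, hx, hL⟩ := h.exists_config_left
  obtain rfl : (fun i => line (x i)) = L := funext hL
  exact Config.injective hx

/-- Two labellings of one set of lines, both without repetition, differ by a bijection. -/
lemma exists_equiv_of_range_eq {α β γ : Type*} {f : α → γ} {g : β → γ}
    (hf : Function.Injective f) (hg : Function.Injective g) (h : range f = range g) :
    ∃ e : α ≃ β, g ∘ e = f := by
  refine ⟨(Equiv.ofInjective f hf).trans
    ((Equiv.setCongr h).trans (Equiv.ofInjective g hg).symm), funext fun a => ?_⟩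
  have := Equiv.apply_symm_apply (Equiv.ofInjective g hg)
    (Equiv.setCongr h (Equiv.ofInjective f hf a))
  exact congrArg Subtype.val this

lemma Isotopic.trans {S T U : Set (AffineSubspace ℝ Space)} (h : Isotopic S T)
    (h' : Isotopic T U) : Isotopic S U := by
  obtain ⟨n, L, M, rfl, rfl, h⟩ := h
  obtain ⟨m, M', N, hM, rfl, h'⟩ := h'
  obtain ⟨e, he⟩ := exists_equiv_of_range_eq h.symm.injective_left h'.injective_left hM.symm
  rw [← EquivLike.range_comp N e]
  rw [← he] at h
  exact isotopic_range (h.trans (h'.comp e.injective))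

/-- An isotopy of a set of lines moves any labelling of it. -/
lemma Isotopic.exists_families {S T : Set (AffineSubspace ℝ Space)} (h : Isotopic S T)
    {L : ι → AffineSubspace ℝ Space} (hL : Function.Injective L) (hS : range L = S) :
    ∃ M, range M = T ∧ IsotopicFamilies L M := by
  obtain ⟨n, L', M, rfl, rfl, h⟩ := h
  obtain ⟨e, rfl⟩ := exists_equiv_of_range_eq hL h.injective_left hS
  exact ⟨M ∘ e, EquivLike.range_comp _ _, h.comp e.injective⟩

lemma Isotopic.isInterlacing {S T : Set (AffineSubspace ℝ Space)} (h : Isotopic S T) {p : ℕ}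
    (hT : T.encard = p) : IsInterlacing p S := by
  obtain ⟨n, L, M, rfl, rfl, h⟩ := h
  have hn : n = p := by
    rw [← Set.image_univ, h.symm.injective_left.encard_image] at hT
    simpa using hT
  subst hn
  obtain ⟨x, hx, hL⟩ := h.exists_config_left
  refine ⟨?_, ?_, ?_⟩
  · rw [← Set.image_univ, h.injective_left.encard_image]
    simp
  · rintro _ ⟨i, rfl⟩
    rw [← hL]
    exact isLine_lineThrough _ (hx.1 i)
  · rintro _ ⟨i, rfl⟩ _ ⟨j, rfl⟩ hij
    rw [← hL, ← hL]
    exact Config.skew hx fun h => hij (by rw [h])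

/-! ### Frames along a configuration -/

/-- A point `a` together with a basis `(e, f, v)`, encoded as `(a, e, f, v)`: the line through `a`
with direction `v`, and a coordinate system transversal to it. -/
abbrev Frame : Type := Space × Space × Space × Space

/-- The oriented volume of the basis of a frame. -/
noncomputable def Frame.vol (F : Frame) : ℝ := _root_.vol F.2.1 F.2.2.1 F.2.2.2

/-- The pointed directed line of a frame. -/
def Frame.core (F : Frame) : Space × Space := (F.1, F.2.2.2)

lemma Frame.continuous_vol : Continuous Frame.vol :=
  _root_.continuous_vol.comp (f := fun F : Frame => F.2) (by fun_prop)

/-- Families of positively oriented frames whose lines are pairwise skew. -/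
def FrameConfig (ι : Type) : Set (ι → Frame) :=
  {F | (∀ i, 0 < (F i).vol) ∧ (fun i => (F i).core) ∈ Config ι}

lemma exists_vol_pos {v : Space} (hv : v ≠ 0) : ∃ e f : Space, 0 < vol e f v := by
  have : v 0 ≠ 0 ∨ v 1 ≠ 0 ∨ v 2 ≠ 0 := by
    by_contra! h
    exact hv (by ext k; fin_cases k <;> simp [h])
  rcases this with h | h | h
  · refine ⟨!₂[0, v 0, 0], !₂[0, 0, 1], ?_⟩
    have := mul_self_pos.2 h
    simpa [vol_eq] using this
  · refine ⟨!₂[0, 0, v 1], !₂[1, 0, 0], ?_⟩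
    have := mul_self_pos.2 h
    simpa [vol_eq] using this
  · refine ⟨!₂[v 2, 0, 0], !₂[0, 1, 0], ?_⟩
    have := mul_self_pos.2 h
    simpa [vol_eq] using this

/-- Cramer's rule. -/
lemma vol_smul_eq (e f v x : Space) :
    vol e f v • x = vol x f v • e + vol e x v • f + vol e f x • v := by
  ext k
  simp only [vol_eq, PiLp.add_apply, PiLp.smul_apply, smul_eq_mul]
  fin_cases k <;> simp only [Fin.zero_eta, Fin.mk_one, Fin.reduceFinMk] <;> ring

/-- Real `2 × 2` matrices of positive determinant form a connected set: a real linear map of the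
complex plane is `z ↦ α z + β z̄`, its determinant is `|α|² - |β|²`, so that `β` can be shrunk to
`0` and then `α` moved to `1`. -/
lemma joinedIn_two_by_two {a b c d : ℝ} (h : 0 < a * d - b * c) :
    JoinedIn {p : ℝ × ℝ × ℝ × ℝ | 0 < p.1 * p.2.2.2 - p.2.1 * p.2.2.1}
      (a, b, c, d) (1, 0, 0, 1) := by
  let P : ℂ × ℂ → ℝ × ℝ × ℝ × ℝ := fun q =>
    (q.1.re + q.2.re, q.2.im - q.1.im, q.1.im + q.2.im, q.1.re - q.2.re)
  have hP : Continuous P := by fun_prop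
  let α : ℂ := ⟨(a + d) / 2, (c - b) / 2⟩
  let β : ℂ := ⟨(a - d) / 2, (c + b) / 2⟩
  have hdet (q : ℂ × ℂ) : (P q).1 * (P q).2.2.2 - (P q).2.1 * (P q).2.2.1
      = Complex.normSq q.1 - Complex.normSq q.2 := by
    simp only [P, Complex.normSq_apply]; ring
  have hαβ : P (α, β) = (a, b, c, d) := by
    simp only [P, α, β, Prod.mk.injEq]
    refine ⟨?_, ?_, ?_, ?_⟩ <;> ring
  have hpos : 0 < Complex.normSq α - Complex.normSq β := by
    have := hdet (α, β)
    rw [hαβ] at this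
    exact this ▸ h
  have h1 : JoinedIn {q : ℂ × ℂ | 0 < Complex.normSq q.1 - Complex.normSq q.2}
      (α, β) (α, 0) := by
    refine JoinedIn.ofLine (f := fun t : ℝ => (α, ((1 - t : ℝ) : ℂ) * β)) (by fun_prop)
      (by simp) (by simp) ?_
    rintro _ ⟨t, ht, rfl⟩
    simp only [mem_ofPred_eq, map_mul, Complex.normSq_ofReal]
    have h0 := Complex.normSq_nonneg β
    have : (1 - t) * (1 - t) ≤ 1 := by nlinarith [ht.1, ht.2]
    nlinarith
  have hα : α ≠ 0 := by
    rw [← Complex.normSq_pos]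
    linarith [Complex.normSq_nonneg β]
  have h2 : JoinedIn {q : ℂ × ℂ | 0 < Complex.normSq q.1 - Complex.normSq q.2}
      (α, 0) (1, 0) := by
    have hpc : IsPathConnected ({0}ᶜ : Set ℂ) :=
      isPathConnected_compl_singleton_of_one_lt_rank (by simp) 0
    refine ((hpc.joinedIn α hα 1 one_ne_zero).map (f := fun z => (z, (0 : ℂ)))
      (by fun_prop)).mono ?_
    rintro _ ⟨z, hz, rfl⟩
    simpa using hz
  have h3 := (h1.trans h2).map hP
  rw [hαβ] at h3
  have h10 : P (1, 0) = (1, 0, 0, 1) := by simp [P]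
  rw [h10] at h3
  refine h3.mono ?_
  rintro _ ⟨q, hq, rfl⟩
  exact (show (0 : ℝ) < _ from hq).trans_eq (hdet q).symm

/-- The frames with a given line are connected to one another. -/
lemma joinedIn_transversal {e f e' f' v : Space} (h : 0 < vol e f v) (h' : 0 < vol e' f' v) :
    JoinedIn {p : Space × Space | 0 < vol p.1 p.2 v} (e', f') (e, f) := by
  set D := vol e f v with hD
  have expand (x : Space) : x = (vol x f v / D) • e + (vol e x v / D) • f
      + (vol e f x / D) • v := by
    have := congrArg (D⁻¹ • ·) (vol_smul_eq e f v x)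
    simp only [← hD, smul_add, smul_smul, inv_mul_cancel₀ h.ne', one_smul] at this
    simpa only [div_eq_inv_mul] using this
  have hvol (a b c d l m : ℝ) : vol (a • e + b • f + l • v) (c • e + d • f + m • v) v
      = (a * d - b * c) * D := by
    simp only [hD, vol_eq, PiLp.add_apply, PiLp.smul_apply, smul_eq_mul]
    ring
  obtain ⟨a, b, l, rfl⟩ : ∃ a b l : ℝ, e' = a • e + b • f + l • v := ⟨_, _, _, expand e'⟩
  obtain ⟨c, d, m, rfl⟩ : ∃ c d m : ℝ, f' = c • e + d • f + m • v := ⟨_, _, _, expand f'⟩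
  rw [hvol] at h'
  have hdet : 0 < a * d - b * c := pos_of_mul_pos_left h' h.le
  have h1 : JoinedIn {p : Space × Space | 0 < vol p.1 p.2 v}
      (a • e + b • f + l • v, c • e + d • f + m • v)
      (a • e + b • f + (0 : ℝ) • v, c • e + d • f + (0 : ℝ) • v) := by
    refine JoinedIn.ofLine (f := fun t : ℝ => (a • e + b • f + ((1 - t) * l) • v,
      c • e + d • f + ((1 - t) * m) • v)) (by fun_prop) (by simp) (by simp) ?_
    rintro _ ⟨t, -, rfl⟩
    simp only [mem_ofPred_eq, hvol]
    exact mul_pos hdet h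
  have h2 := (joinedIn_two_by_two hdet).map (f := fun p : ℝ × ℝ × ℝ × ℝ =>
    (p.1 • e + p.2.1 • f + (0 : ℝ) • v, p.2.2.1 • e + p.2.2.2 • f + (0 : ℝ) • v)) (by fun_prop)
  refine h1.trans ?_
  simp only [zero_smul, one_smul, add_zero, zero_add] at h2 ⊢
  refine h2.mono ?_
  rintro _ ⟨p, hp, rfl⟩
  have := hvol p.1 p.2.1 p.2.2.1 p.2.2.2 0 0
  simp only [zero_smul, add_zero] at this
  simp only [mem_ofPred_eq, this]
  exact mul_pos hp h

/-- Families of frames with the same lines are connected to one another. -/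
lemma FrameConfig.joinedIn_of_core_eq {F F' : ι → Frame} (hF : F ∈ FrameConfig ι)
    (hF' : F' ∈ FrameConfig ι) (hc : ∀ i, (F i).core = (F' i).core) :
    JoinedIn (FrameConfig ι) F F' := by
  have key (i : ι) : JoinedIn {G : Frame | 0 < G.vol ∧ G.core = (F i).core} (F i) (F' i) := by
    have hv : (F' i).2.2.2 = (F i).2.2.2 := (congrArg Prod.snd (hc i)).symm
    have ha : (F' i).1 = (F i).1 := (congrArg Prod.fst (hc i)).symm
    have h1 := hF.1 i
    have h2 := hF'.1 i
    unfold Frame.vol at h1 h2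
    rw [hv] at h2
    have := (joinedIn_transversal h2 h1).map (f := fun p : Space × Space =>
      (((F i).1, p.1, p.2, (F i).2.2.2) : Frame)) (by fun_prop)
    have e2 : ((F i).1, (F' i).2.1, (F' i).2.2.1, (F i).2.2.2) = F' i := by
      rw [← ha, ← hv]
    simp only at this
    rw [e2] at this
    refine this.mono ?_
    rintro _ ⟨p, hp, rfl⟩
    exact ⟨hp, rfl⟩
  refine (JoinedIn.pi key).mono fun G hG => ?_
  have hG' (i) := hG i (mem_univ i)
  exact ⟨fun i => (hG' i).1, by rw [funext fun i => (hG' i).2]; exact hF.2⟩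

lemma exists_frameConfig {x : ι → Space × Space} (hx : x ∈ Config ι) :
    ∃ F ∈ FrameConfig ι, ∀ i, (F i).core = x i := by
  choose e f h using fun i => exists_vol_pos (hx.1 i)
  exact ⟨fun i => ((x i).1, e i, f i, (x i).2), ⟨h, hx⟩, fun i => rfl⟩

/-- A motion of skew lines extends to a motion of frames with prescribed ends. Along a short piece
of the motion the transversal vectors of a frame can be kept fixed; hence whether a given frame can
be carried to time `t` does not depend on `t`. -/
lemma FrameConfig.joinedIn_of_core_joinedIn [Finite ι] {F F' : ι → Frame}
    (hF : F ∈ FrameConfig ι) (hF' : F' ∈ FrameConfig ι)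
    (h : JoinedIn (Config ι) (fun i => (F i).core) fun i => (F' i).core) :
    JoinedIn (FrameConfig ι) F F' := by
  obtain ⟨γ, hγ⟩ := h
  have hγ' (t : ℝ) : γ.extend t ∈ Config ι := hγ _
  let P : ℝ → Prop := fun t =>
    ∃ G, (∀ i, (G i).core = γ.extend t i) ∧ JoinedIn (FrameConfig ι) F G
  have hP : IsLocallyConstant P := by
    rw [IsLocallyConstant.iff_eventually_eq]
    intro t₀
    obtain ⟨G₀, hG₀, hcore⟩ := exists_frameConfig (hγ' t₀)
    let G : ℝ → ι → Frame := fun t i =>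
      ((γ.extend t i).1, (G₀ i).2.1, (G₀ i).2.2.1, (γ.extend t i).2)
    have hGcont : Continuous G := by
      have := γ.continuous_extend
      fun_prop
    have hGt₀ : G t₀ = G₀ := by
      funext i
      change ((γ.extend t₀ i).1, (G₀ i).2.1, (G₀ i).2.2.1, (γ.extend t₀ i).2) = G₀ i
      rw [← hcore i]
      rfl
    have hopen : IsOpen {t | ∀ i, 0 < (G t i).vol} := by
      simp only [ofPred_forall]
      refine isOpen_iInter_of_finite fun i => ?_
      exact isOpen_lt continuous_const
        (Frame.continuous_vol.comp ((continuous_apply i).comp hGcont))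
    have hmem : t₀ ∈ {t | ∀ i, 0 < (G t i).vol} := by
      intro i; rw [hGt₀]; exact hG₀.1 i
    obtain ⟨r, hr, hball⟩ := Metric.isOpen_iff.1 hopen t₀ hmem
    filter_upwards [Metric.ball_mem_nhds t₀ hr] with t ht
    have hj : JoinedIn (FrameConfig ι) G₀ (G t) := by
      have : JoinedIn (Metric.ball t₀ r) t₀ t :=
        ((convex_ball t₀ r).isPathConnected ⟨t, ht⟩).joinedIn _ (Metric.mem_ball_self hr) _ ht
      rw [← hGt₀]
      refine (this.map hGcont).mono ?_
      rintro _ ⟨s, hs, rfl⟩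
      exact ⟨hball hs, hγ' s⟩
    refine propext ⟨?_, ?_⟩
    · rintro ⟨G', hc, hj'⟩
      exact ⟨G₀, hcore, (hj'.trans (FrameConfig.joinedIn_of_core_eq hj'.target_mem
        hj.target_mem fun i => (hc i).trans rfl)).trans hj.symm⟩
    · rintro ⟨G', hc, hj'⟩
      exact ⟨G t, fun i => rfl, (hj'.trans (FrameConfig.joinedIn_of_core_eq hj'.target_mem
        hG₀ fun i => (hc i).trans (hcore i).symm)).trans hj⟩
  have h0 : P 0 := ⟨F, fun i => by simp, JoinedIn.refl hF⟩
  have h1 : P 1 := by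
    rw [← hP.apply_eq_of_preconnectedSpace 0 1]; exact h0
  obtain ⟨G, hc, hj⟩ := h1
  refine hj.trans (FrameConfig.joinedIn_of_core_eq hj.target_mem hF' fun i => ?_)
  rw [hc i]; simp

lemma joinedIn_config_of_subsingleton [Subsingleton ι] {x y : ι → Space × Space}
    (hx : x ∈ Config ι) (hy : y ∈ Config ι) : JoinedIn (Config ι) x y := by
  have hpc : IsPathConnected ({0}ᶜ : Set Space) :=
    isPathConnected_compl_singleton_of_one_lt_rank
      (by rw [← Module.finrank_eq_rank]; simp) 0
  have h1 (a b : Space) : JoinedIn (univ : Set Space) a b :=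
    isPathConnected_univ.joinedIn _ trivial _ trivial
  refine (JoinedIn.pi fun i =>
    (h1 (x i).1 (y i).1).prod (hpc.joinedIn _ (hx.1 i) _ (hy.1 i))).mono ?_
  exact fun z hz => ⟨fun i => (hz i trivial).2, fun i j hij => absurd (Subsingleton.elim i j) hij⟩

/-- The space of positively oriented frames is connected. -/
lemma joinedIn_frame {F F' : Frame} (hF : 0 < F.vol) (hF' : 0 < F'.vol) :
    JoinedIn {G : Frame | 0 < G.vol} F F' := by
  have hne {G : Frame} (hG : 0 < G.vol) : G.2.2.2 ≠ 0 := by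
    intro h
    simp [Frame.vol, h, vol_eq] at hG
  have hmem {G : Frame} (hG : 0 < G.vol) : (fun _ : Unit => G.core) ∈ Config Unit :=
    ⟨fun _ => hne hG, fun i j hij => absurd rfl hij⟩
  have hj := joinedIn_config_of_subsingleton (hmem hF) (hmem hF')
  have := FrameConfig.joinedIn_of_core_joinedIn (F := fun _ : Unit => F) (F' := fun _ => F')
    ⟨fun _ => hF, hj.source_mem⟩ ⟨fun _ => hF', hj.target_mem⟩ hj
  refine (this.map (f := fun G => G ()) (by fun_prop)).mono ?_
  rintro _ ⟨G, hG, rfl⟩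
  exact hG.1 ()

lemma joinedIn_pair {x y : Fin 2 → Space × Space} (hx : 0 < pairDet (x 0) (x 1))
    (hy : 0 < pairDet (y 0) (y 1)) : JoinedIn (Config (Fin 2)) x y := by
  let P : Frame → Fin 2 → Space × Space := fun F => ![(F.1 + F.2.2.2, F.2.1), (F.1, F.2.2.1)]
  have hP : Continuous P := by
    refine continuous_pi fun i => ?_
    fin_cases i
    · change Continuous fun F : Frame => (F.1 + F.2.2.2, F.2.1)
      fun_prop
    · change Continuous fun F : Frame => (F.1, F.2.2.1)
      fun_prop
  let Q : (Fin 2 → Space × Space) → Frame := fun x =>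
    ((x 1).1, (x 0).2, (x 1).2, (x 0).1 - (x 1).1)
  have hPQ (x) : P (Q x) = x := by
    funext i
    fin_cases i <;> simp [P, Q]
  have hdet (F : Frame) : pairDet (P F 0) (P F 1) = F.vol := by
    simp [P, pairDet, Frame.vol]
  have h := (joinedIn_frame (F := Q x) (F' := Q y) (by rw [← hdet, hPQ]; exact hx)
    (by rw [← hdet, hPQ]; exact hy)).map hP
  rw [hPQ, hPQ] at h
  refine h.mono ?_
  rintro _ ⟨F, hF, rfl⟩
  have hd : pairDet (P F 0) (P F 1) ≠ 0 := by rw [hdet]; exact (show 0 < F.vol from hF).ne'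
  have hd' : pairDet (P F 1) (P F 0) ≠ 0 := by rwa [pairDet_comm]
  refine ⟨fun i => ?_, fun i j hij => ?_⟩
  · fin_cases i
    · exact (ne_zero_of_vol_ne_zero hd).1
    · exact (ne_zero_of_vol_ne_zero hd).2
  · fin_cases i <;> fin_cases j <;> first | exact absurd rfl hij | exact hd | exact hd'

/-- Any two labelled pairs of skew lines are isotopic: reversing the direction of one line changes
the sign of the determinant. -/
lemma isotopicFamilies_pair {X Y : Fin 2 → AffineSubspace ℝ Space} (hX : ∀ i, IsLine (X i))
    (hX' : Skew (X 0) (X 1)) (hY : ∀ i, IsLine (Y i)) (hY' : Skew (Y 0) (Y 1)) :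
    IsotopicFamilies X Y := by
  have key (X : Fin 2 → AffineSubspace ℝ Space) (hX : ∀ i, IsLine (X i))
      (hX' : Skew (X 0) (X 1)) : ∃ x : Fin 2 → Space × Space, 0 < pairDet (x 0) (x 1) ∧
        ∀ i, line (x i) = X i := by
    obtain ⟨x, hx, hL⟩ := exists_config hX (fun i j hij => by
      fin_cases i <;> fin_cases j <;>
        first | exact absurd rfl hij | exact hX' | exact hX'.symm)
    have hne := hx.2 0 1 (by decide)
    rcases hne.lt_or_gt with h | h
    · refine ⟨![reparam (-1) 0 (x 0), reparam 1 0 (x 1)], ?_, fun i => ?_⟩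
      · simp only [Matrix.cons_val_zero, Matrix.cons_val_one, pairDet_reparam]
        linarith
      · fin_cases i
        · exact (line_reparam (by norm_num) _ _).trans (hL 0)
        · exact (line_reparam (by norm_num) _ _).trans (hL 1)
    · exact ⟨x, h, hL⟩
  obtain ⟨x, hx, hxL⟩ := key X hX hX'
  obtain ⟨y, hy, hyL⟩ := key Y hY hY'
  exact isotopicFamilies_iff.2 ⟨x, y, joinedIn_pair hx hy, hxL, hyL⟩

/-! ### Generatrices of thin hyperboloids -/

/-- Coordinates `(α, β)` of the lines near the line of a frame. -/
abbrev LocalCoord : Type := (ℝ × ℝ) × (ℝ × ℝ)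

/-- The line near the line of the frame `F = (a, e, f, v)` that passes through `a + α₁ e + α₂ f` in
the direction `v + β₁ e + β₂ f`, where `z = (α, β)`. -/
noncomputable def Frame.near (F : Frame) (z : LocalCoord) : Space × Space :=
  (F.1 + z.1.1 • F.2.1 + z.1.2 • F.2.2.1, F.2.2.2 + z.2.1 • F.2.1 + z.2.2 • F.2.2.1)

lemma Frame.continuous_near : Continuous fun p : Frame × LocalCoord => p.1.near p.2 := by
  unfold Frame.near
  fun_prop

lemma Frame.near_zero (F : Frame) : F.near 0 = F.core := by
  simp [Frame.near, Frame.core]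

lemma Frame.pairDet_near (F : Frame) (z z' : LocalCoord) :
    pairDet (F.near z) (F.near z') = F.vol * ((z.1.1 - z'.1.1) * (z.2.2 - z'.2.2)
      - (z.1.2 - z'.1.2) * (z.2.1 - z'.2.1)) := by
  simp only [pairDet, Frame.near, Frame.vol, vol_eq, PiLp.sub_apply, PiLp.add_apply,
    PiLp.smul_apply, smul_eq_mul]
  ring

lemma Frame.near_direction_ne_zero {F : Frame} (hF : 0 < F.vol) (z : LocalCoord) :
    (F.near z).2 ≠ 0 := by
  intro h
  have h1 : _root_.vol F.2.1 F.2.2.1 (F.near z).2 = F.vol := by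
    simp only [Frame.near, Frame.vol, vol_eq, PiLp.add_apply, PiLp.smul_apply, smul_eq_mul]
    ring
  rw [h] at h1
  simp [vol_eq] at h1
  exact hF.ne h1

/-- The local coordinates of the generatrices of the hyperboloid of radius `s` around the line of a
frame; `ε` is the sign of the family. -/
noncomputable def circlePoint (s ε : ℝ) (θ : Real.Angle) : LocalCoord :=
  ((s * θ.cos, s * θ.sin), (-(s * ε * θ.sin), s * ε * θ.cos))

lemma norm_circlePoint_le {s ε : ℝ} (hs : 0 ≤ s) (hε : |ε| ≤ 1) (θ : Real.Angle) :
    ‖circlePoint s ε θ‖ ≤ s := by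
  have hc : |θ.cos| ≤ 1 := by
    induction θ using Real.Angle.induction_on with | _ t => exact Real.abs_cos_le_one t
  have hd : |θ.sin| ≤ 1 := by
    induction θ using Real.Angle.induction_on with | _ t => exact Real.abs_sin_le_one t
  simp only [circlePoint, Prod.norm_def, Real.norm_eq_abs, abs_neg, abs_mul, abs_of_nonneg hs,
    sup_le_iff]
  have h1 : s * |ε| ≤ s := mul_le_of_le_one_right hs hε
  have h2 : 0 ≤ s * |ε| := by positivity
  refine ⟨⟨?_, ?_⟩, ?_, ?_⟩
  · exact mul_le_of_le_one_right hs hc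
  · exact mul_le_of_le_one_right hs hd
  · exact (mul_le_of_le_one_right h2 hd).trans h1
  · exact (mul_le_of_le_one_right h2 hc).trans h1

lemma Frame.pairDet_near_circlePoint (F : Frame) (s ε : ℝ) (θ θ' : Real.Angle) :
    pairDet (F.near (circlePoint s ε θ)) (F.near (circlePoint s ε θ')) =
      F.vol * (ε * (s ^ 2 * ((θ.cos - θ'.cos) ^ 2 + (θ.sin - θ'.sin) ^ 2))) := by
  rw [Frame.pairDet_near]
  simp only [circlePoint]
  ring

lemma cos_sin_dist_pos {θ θ' : Real.Angle} (h : θ ≠ θ') :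
    0 < (θ.cos - θ'.cos) ^ 2 + (θ.sin - θ'.sin) ^ 2 := by
  by_contra! h0
  have h1 : θ.cos - θ'.cos = 0 :=
    pow_eq_zero_iff two_ne_zero |>.1
      (by linarith [sq_nonneg (θ.cos - θ'.cos), sq_nonneg (θ.sin - θ'.sin)])
  have h2 : θ.sin - θ'.sin = 0 :=
    pow_eq_zero_iff two_ne_zero |>.1
      (by linarith [sq_nonneg (θ.cos - θ'.cos), sq_nonneg (θ.sin - θ'.sin)])
  apply h
  induction θ using Real.Angle.induction_on with | _ t =>
  induction θ' using Real.Angle.induction_on with | _ t' =>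
  exact Real.Angle.cos_sin_inj (sub_eq_zero.1 h1) (sub_eq_zero.1 h2)

/-- Every line of the frame `F i` is replaced by the generatrices with angles in `Θ i`, in the
family of sign `ε i`, on a hyperboloid of radius `s` around it. -/
noncomputable def thinSet (F : ι → Frame) (s : ℝ) (ε : ι → ℤˣ) (Θ : ι → Finset Real.Angle) :
    Set (AffineSubspace ℝ Space) :=
  ⋃ i, (fun θ => line ((F i).near (circlePoint s ((ε i : ℤ) : ℝ) θ))) '' (Θ i : Set Real.Angle)

/-- Lines close enough to different lines of a configuration remain skew, uniformly over a compact
set of configurations. -/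
lemma exists_radius [Finite ι] {K : Set (ι → Frame)} (hK : IsCompact K)
    (hKF : K ⊆ FrameConfig ι) :
    ∃ r > 0, ∀ F ∈ K, ∀ i j, i ≠ j → ∀ z z' : LocalCoord, ‖z‖ < r → ‖z'‖ < r →
      pairDet ((F i).near z) ((F j).near z') ≠ 0 := by
  have := Fintype.ofFinite ι
  let Ω : Set ((ι → Frame) × (LocalCoord × LocalCoord)) :=
    {p | ∀ i j, i ≠ j → pairDet ((p.1 i).near p.2.1) ((p.1 j).near p.2.2) ≠ 0}
  have hcont (i j : ι) : Continuous fun p : (ι → Frame) × (LocalCoord × LocalCoord) =>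
      pairDet ((p.1 i).near p.2.1) ((p.1 j).near p.2.2) := by
    have h1 : Continuous fun p : (ι → Frame) × (LocalCoord × LocalCoord) => (p.1 i).near p.2.1 :=
      Frame.continuous_near.comp
        (f := fun p : (ι → Frame) × (LocalCoord × LocalCoord) => (p.1 i, p.2.1))
        (((continuous_apply i).comp continuous_fst).prodMk (continuous_fst.comp continuous_snd))
    have h2 : Continuous fun p : (ι → Frame) × (LocalCoord × LocalCoord) => (p.1 j).near p.2.2 :=
      Frame.continuous_near.comp
        (f := fun p : (ι → Frame) × (LocalCoord × LocalCoord) => (p.1 j, p.2.2))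
        (((continuous_apply j).comp continuous_fst).prodMk (continuous_snd.comp continuous_snd))
    exact continuous_pairDet.comp (f := fun p : (ι → Frame) × (LocalCoord × LocalCoord) =>
      ((p.1 i).near p.2.1, (p.1 j).near p.2.2)) (h1.prodMk h2)
  have hΩ : IsOpen Ω := by
    simp only [Ω, ofPred_forall]
    exact isOpen_iInter_of_finite fun i => isOpen_iInter_of_finite fun j =>
      isOpen_iInter_of_finite fun _ => isOpen_ne_fun (hcont i j) continuous_const
  have hsub : K ×ˢ {(0 : LocalCoord × LocalCoord)} ⊆ Ω := by
    rintro ⟨F, z⟩ ⟨hF, rfl⟩ i j hij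
    simp only [Prod.fst_zero, Prod.snd_zero, Frame.near_zero]
    exact (hKF hF).2.2 i j hij
  obtain ⟨r, hr, hthick⟩ := (hK.prod isCompact_singleton).exists_thickening_subset_open hΩ hsub
  refine ⟨r, hr, fun F hF i j hij z z' hz hz' => ?_⟩
  have : (F, (z, z')) ∈ Metric.thickening r (K ×ˢ {(0 : LocalCoord × LocalCoord)}) := by
    rw [Metric.mem_thickening_iff]
    refine ⟨(F, 0), ⟨hF, rfl⟩, ?_⟩
    rw [Prod.dist_eq, dist_self, dist_zero_right, Prod.norm_def]
    exact max_lt hr (max_lt hz hz')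
  exact hthick this i j hij

/-- A finite set of angles, listed in increasing order of the representatives in `(-π, π]`. -/
lemma exists_sorted_angles (Θ : Finset Real.Angle) {n : ℕ} (hn : Θ.card = n) :
    ∃ τ : Fin n → ℝ, StrictMono τ ∧ (∀ j, τ j ∈ Ioc (-Real.pi) Real.pi) ∧
      range (fun j => (τ j : Real.Angle)) = Θ := by
  have hcard : (Θ.image Real.Angle.toReal).card = n := by
    rw [Finset.card_image_of_injective _ Real.Angle.toReal_injective, hn]
  have hrange := Finset.range_orderEmbOfFin (Θ.image Real.Angle.toReal) hcard
  refine ⟨(Θ.image Real.Angle.toReal).orderEmbOfFin hcard, OrderEmbedding.strictMono _,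
    fun j => ?_, ?_⟩
  · obtain ⟨θ, -, hθ⟩ := Finset.mem_image.1 (Finset.orderEmbOfFin_mem _ hcard j)
    rw [← hθ]
    exact Real.Angle.toReal_mem_Ioc θ
  · rw [show (fun j => (((Θ.image Real.Angle.toReal).orderEmbOfFin hcard j : ℝ) : Real.Angle)) =
      (fun x : ℝ => (x : Real.Angle)) ∘ (Θ.image Real.Angle.toReal).orderEmbOfFin hcard from rfl,
      range_comp, hrange, Finset.coe_image, image_image]
    simp

lemma angle_coe_ne {x y : ℝ} (hx : x ∈ Ioc (-Real.pi) Real.pi) (hy : y ∈ Ioc (-Real.pi) Real.pi)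
    (h : x ≠ y) : (x : Real.Angle) ≠ y := by
  intro he
  apply h
  rw [← Real.Angle.toReal_coe_eq_self_iff_mem_Ioc.2 hx, he,
    Real.Angle.toReal_coe_eq_self_iff_mem_Ioc.2 hy]

lemma thinSet_eq_range {F : ι → Frame} {s : ℝ} {ε : ι → ℤˣ} {Θ : ι → Finset Real.Angle}
    {n : ι → ℕ} {τ : ∀ i, Fin (n i) → ℝ}
    (hτ : ∀ i, range (fun j => (τ i j : Real.Angle)) = Θ i) :
    thinSet F s ε Θ = range fun p : Σ i, Fin (n i) =>
      line ((F p.1).near (circlePoint s ((ε p.1 : ℤ) : ℝ) (τ p.1 p.2))) := by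
  rw [thinSet, range_sigma_eq_iUnion_range]
  refine iUnion_congr fun i => ?_
  rw [← hτ i, ← range_comp]
  rfl

lemma abs_units_cast (u : ℤˣ) : |((u : ℤ) : ℝ)| = 1 := by
  rcases Int.units_eq_one_or u with rfl | rfl <;> simp

/-- Lines close to the lines of a configuration form a configuration when those close to the same
line are skew to one another. -/
lemma near_mem_config {κ : Type} {π : κ → ι} {F : ι → Frame} (hF : ∀ i, 0 < (F i).vol)
    {z : κ → LocalCoord}
    (hne : ∀ p q, π p ≠ π q → pairDet ((F (π p)).near (z p)) ((F (π q)).near (z q)) ≠ 0)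
    (heq : ∀ p q, p ≠ q → π p = π q →
      pairDet ((F (π p)).near (z p)) ((F (π p)).near (z q)) ≠ 0) :
    (fun p => (F (π p)).near (z p)) ∈ Config κ := by
  refine ⟨fun p => Frame.near_direction_ne_zero (hF _) _, fun p q hpq => ?_⟩
  by_cases h : π p = π q
  · have := heq p q hpq h
    simp only [← h]
    exact this
  · exact hne p q h

/-- Moving the core lines, and the angles of the generatrices without changing their cyclic order,
does not change the isotopy type of a thin replacement. A line replaced by a single generatrix has
no sign. -/
lemma FrameConfig.isotopic_thinSet [Finite ι] {F F' : ι → Frame}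
    (h : JoinedIn (FrameConfig ι) F F') {ε ε' : ι → ℤˣ} {Θ Θ' : ι → Finset Real.Angle}
    (hΘ : ∀ i, (Θ i).card = (Θ' i).card) (hε : ∀ i, ε i = ε' i ∨ (Θ i).card ≤ 1) :
    ∃ r > 0, ∀ s, 0 < s → s < r → Isotopic (thinSet F s ε Θ) (thinSet F' s ε' Θ') := by
  obtain ⟨γ, hγ⟩ := h
  obtain ⟨r, hr, hcross⟩ := exists_radius (isCompact_range γ.continuous)
    (range_subset_iff.2 hγ)
  refine ⟨r, hr, fun s hs hsr => ?_⟩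
  choose τ hmono hmem hrange using fun i => exists_sorted_angles (Θ i) rfl
  choose τ' hmono' hmem' hrange' using fun i => exists_sorted_angles (Θ' i) (hΘ i).symm
  rw [thinSet_eq_range hrange, thinSet_eq_range hrange']
  refine isotopic_range (isotopicFamilies_of_joinedIn ?_)
  have hdist {i : ι} {τ : Fin (Θ i).card → ℝ} (h1 : StrictMono τ)
      (h2 : ∀ j, τ j ∈ Ioc (-Real.pi) Real.pi) {j j' : Fin (Θ i).card} (hj : j ≠ j') :=
    cos_sin_dist_pos (angle_coe_ne (h2 j) (h2 j') (h1.injective.ne hj))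
  have hzr {ε : ℝ} (hε : |ε| ≤ 1) (θ : Real.Angle) : ‖circlePoint s ε θ‖ < r :=
    (norm_circlePoint_le hs.le hε θ).trans_lt hsr
  have hunit (u : ℤˣ) : ((u : ℤ) : ℝ) ≠ 0 := by
    rw [← abs_pos, abs_units_cast]; exact one_pos
  have move_core : JoinedIn (Config (Σ i, Fin (Θ i).card))
      (fun p => (F p.1).near (circlePoint s ((ε p.1 : ℤ) : ℝ) (τ p.1 p.2)))
      fun p => (F' p.1).near (circlePoint s ((ε p.1 : ℤ) : ℝ) (τ p.1 p.2)) := by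
    have hj : JoinedIn (range γ) F F' := ⟨γ, fun t => mem_range_self t⟩
    refine (hj.map (f := fun G (p : Σ i, Fin (Θ i).card) =>
      (G p.1).near (circlePoint s ((ε p.1 : ℤ) : ℝ) (τ p.1 p.2))) ?_).mono ?_
    · refine continuous_pi fun p => Frame.continuous_near.comp
        (f := fun G : ι → Frame => (G p.1, circlePoint s ((ε p.1 : ℤ) : ℝ) (τ p.1 p.2)))
        (by fun_prop)
    · rintro _ ⟨G, hG, rfl⟩
      have hGF : G ∈ FrameConfig ι := by obtain ⟨t, rfl⟩ := hG; exact hγ t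
      refine near_mem_config (π := Sigma.fst) hGF.1 (fun p q hpq => ?_) ?_
      · exact hcross G hG _ _ hpq _ _ (hzr (abs_units_cast _).le _) (hzr (abs_units_cast _).le _)
      · rintro ⟨i, j⟩ ⟨i', j'⟩ hpq (rfl : i = i')
        rw [Frame.pairDet_near_circlePoint]
        have hj : j ≠ j' := fun h => hpq (by rw [h])
        exact mul_ne_zero (hGF.1 i).ne' (mul_ne_zero (hunit _)
          (mul_pos (pow_pos hs 2) (hdist (hmono i) (hmem i) hj)).ne')
  refine move_core.trans ?_
  -- Convex combinations of increasing sequences in `(-π, π]` are such sequences.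
  let σ : ℝ → ∀ i, Fin (Θ i).card → ℝ := fun t i j => (1 - t) * τ i j + t * τ' i j
  let e : ℝ → ι → ℝ := fun t i => (1 - t) * ((ε i : ℤ) : ℝ) + t * ((ε' i : ℤ) : ℝ)
  refine JoinedIn.ofLine (f := fun t (p : Σ i, Fin (Θ i).card) =>
    (F' p.1).near (circlePoint s (e t p.1) (σ t p.1 p.2))) ?_ (by simp [σ, e]) (by simp [σ, e]) ?_
  · refine Continuous.continuousOn (continuous_pi fun p => Frame.continuous_near.comp
      (f := fun t => (F' p.1, circlePoint s (e t p.1) (σ t p.1 p.2))) ?_)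
    simp only [circlePoint, Real.Angle.cos_coe, Real.Angle.sin_coe, σ, e]
    fun_prop
  · rintro _ ⟨t, ht, rfl⟩
    have hF' : F' ∈ range γ := ⟨1, γ.target⟩
    have hFC : F' ∈ FrameConfig ι := by rw [← γ.target]; exact hγ 1
    have ht0 : 0 ≤ t := ht.1
    have ht1 : 0 ≤ 1 - t := sub_nonneg.2 ht.2
    have he (i : ι) : |e t i| ≤ 1 := by
      calc |e t i| ≤ |(1 - t) * ((ε i : ℤ) : ℝ)| + |t * ((ε' i : ℤ) : ℝ)| := abs_add_le _ _
        _ = 1 := by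
          rw [abs_mul, abs_mul, abs_units_cast, abs_units_cast, abs_of_nonneg ht0,
            abs_of_nonneg ht1]
          ring
    have hσmono (i : ι) : StrictMono (σ t i) := by
      intro j j' hj
      have h1 := hmono i hj
      have h2 := hmono' i hj
      simp only [σ]
      rcases ht0.eq_or_lt with rfl | h0
      · simpa using h1
      · have := mul_lt_mul_of_pos_left h2 h0
        have := mul_le_mul_of_nonneg_left h1.le ht1
        linarith
    have hσmem (i : ι) (j : Fin (Θ i).card) : σ t i j ∈ Ioc (-Real.pi) Real.pi :=
      convex_Ioc _ _ (hmem i j) (hmem' i j) ht1 ht0 (by ring)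
    refine near_mem_config (π := Sigma.fst) hFC.1 (fun p q hpq => ?_) ?_
    · exact hcross F' hF' _ _ hpq _ _ (hzr (he _) _) (hzr (he _) _)
    · rintro ⟨i, j⟩ ⟨i', j'⟩ hpq (rfl : i = i')
      rw [Frame.pairDet_near_circlePoint]
      have hj : j ≠ j' := fun h => hpq (by rw [h])
      have hei : e t i ≠ 0 := by
        rcases hε i with h | h
        · have : e t i = ((ε i : ℤ) : ℝ) := by simp only [e, ← h]; ring
          rw [this]; exact hunit _
        · have := Fin.subsingleton_iff_le_one.2 h
          exact absurd (Subsingleton.elim j j') hj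
      exact mul_ne_zero (hFC.1 i).ne' (mul_ne_zero hei
        (mul_pos (pow_pos hs 2) (hdist (hσmono i) (hσmem i) hj)).ne')

/-- The rotation of a frame through `π` about its vector `e`. -/
def Frame.flip (F : Frame) : Frame := (F.1, F.2.1, -F.2.2.1, -F.2.2.2)

lemma Frame.vol_flip (F : Frame) : F.flip.vol = F.vol := by
  simp only [Frame.flip, Frame.vol, vol_eq, PiLp.neg_apply]
  ring

lemma Frame.line_near_flip (F : Frame) (s ε : ℝ) (θ : Real.Angle) :
    line (F.flip.near (circlePoint s ε (-θ))) = line (F.near (circlePoint s ε θ)) := by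
  rw [← line_reparam (c := -1) (by norm_num) 0 (F.near _)]
  congr 1
  simp only [Frame.near, Frame.flip, circlePoint, reparam, Real.Angle.cos_neg, Real.Angle.sin_neg,
    Prod.mk.injEq]
  constructor <;> module

lemma Frame.core_flip (F : Frame) : F.flip.core = reparam (-1) 0 F.core := by
  simp [Frame.flip, Frame.core, reparam]

/-- Thin replacements of isotopic families of lines are isotopic. -/
lemma isotopic_thinSet [Finite ι] {F F' : ι → Frame} (hF : F ∈ FrameConfig ι)
    (hF' : F' ∈ FrameConfig ι)
    (h : IsotopicFamilies (fun i => line (F i).core) fun i => line (F' i).core)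
    {ε ε' : ι → ℤˣ} {Θ Θ' : ι → Finset Real.Angle}
    (hΘ : ∀ i, (Θ i).card = (Θ' i).card) (hε : ∀ i, ε i = ε' i ∨ (Θ i).card ≤ 1) :
    ∃ r > 0, ∀ s, 0 < s → s < r → Isotopic (thinSet F s ε Θ) (thinSet F' s ε' Θ') := by
  classical
  obtain ⟨y, hy, hyL⟩ := IsotopicFamilies.lift h hF.2.1 fun _ => rfl
  choose c d hc hyc using fun i => exists_reparam (hy.target_mem.1 i) (hyL i)
  -- The isotopy may reverse the direction of a line; its frame is then rotated through `π`.
  let G : ι → Frame := fun i => if 0 < c i then F' i else (F' i).flip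
  let Ψ : ι → Finset Real.Angle := fun i => if 0 < c i then Θ' i else (Θ' i).image Neg.neg
  let u : ι → ℝ := fun i => if 0 < c i then 1 else -1
  have hu (i : ι) : u i ≠ 0 ∧ u i * u i = 1 ∧ 0 < c i * u i := by
    by_cases h : 0 < c i
    · simp [u, h]
    · have : c i < 0 := lt_of_le_of_ne (not_lt.1 h) (hc i)
      simp [u, h, this]
  have hcore : (fun i => (G i).core) = fun i => reparam (u i) 0 (F' i).core := by
    funext i
    by_cases h : 0 < c i
    · simp [G, u, h, reparam]
    · simp [G, u, h, Frame.core_flip]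
  have hGconf : (fun i => (G i).core) ∈ Config ι := by
    rw [hcore]
    exact Config.reparam hF'.2 _ fun i => (hu i).1
  have hG : G ∈ FrameConfig ι := by
    refine ⟨fun i => ?_, hGconf⟩
    by_cases h : 0 < c i
    · simpa [G, h] using hF'.1 i
    · simpa [G, h, Frame.vol_flip] using hF'.1 i
  have hΨ (i : ι) : (Θ i).card = (Ψ i).card := by
    by_cases h : 0 < c i
    · simpa [Ψ, h] using hΘ i
    · simpa [Ψ, h, Finset.card_image_of_injective _ neg_injective] using hΘ i
  have hthin (s : ℝ) : thinSet G s ε' Ψ = thinSet F' s ε' Θ' := by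
    refine iUnion_congr fun i => ?_
    by_cases h : 0 < c i
    · simp [G, Ψ, h]
    · simp only [G, Ψ, if_neg h, Finset.coe_image, image_image, Frame.line_near_flip]
  have hj : JoinedIn (Config ι) y fun i => (G i).core := by
    refine JoinedIn.ofLine (f := fun t i => reparam ((1 - t) * (c i * u i) + t)
      ((1 - t) * (d i * u i)) (G i).core) ?_ ?_ ?_ ?_
    · unfold reparam
      fun_prop
    · funext i
      rw [hyc i, congrFun hcore i]
      simp only [reparam, sub_zero, one_mul, zero_smul, add_zero, smul_smul, mul_assoc,
        (hu i).2.1, mul_one]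
    · funext i
      simp [reparam]
    · rintro _ ⟨t, ht, rfl⟩
      refine Config.reparam hGconf _ fun i => ?_
      have h1 : 0 ≤ 1 - t := sub_nonneg.2 ht.2
      have h2 := (hu i).2.2
      rcases ht.1.eq_or_lt with rfl | h0
      · simpa using h2.ne'
      · positivity
  obtain ⟨r, hr, H⟩ := FrameConfig.isotopic_thinSet
    (FrameConfig.joinedIn_of_core_joinedIn hF hG (hy.trans hj)) hΨ hε (ε' := ε')
  exact ⟨r, hr, fun s hs hsr => hthin s ▸ H s hs hsr⟩

/-! ### Replacements by generatrices of hyperboloids -/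

/-- The image of the standard frame under an affine automorphism. -/
noncomputable def frameOf (g : Space ≃ᵃ[ℝ] Space) : Frame :=
  (g 0, g.linear (EuclideanSpace.single 0 1), g.linear (EuclideanSpace.single 1 1),
    g.linear (EuclideanSpace.single 2 1))

lemma vol_map_single (f : Space →ₗ[ℝ] Space) :
    vol (f (EuclideanSpace.single 0 1)) (f (EuclideanSpace.single 1 1))
      (f (EuclideanSpace.single 2 1)) = LinearMap.det f := by
  rw [← LinearMap.det_toMatrix (EuclideanSpace.basisFun (Fin 3) ℝ).toBasis,
    ← Matrix.det_transpose, vol]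
  congr 1
  ext i j
  fin_cases i <;> simp [LinearMap.toMatrix_apply]

lemma vol_frameOf (g : Space ≃ᵃ[ℝ] Space) :
    (frameOf g).vol = LinearMap.det (g.linear : Space →ₗ[ℝ] Space) :=
  vol_map_single (g.linear : Space →ₗ[ℝ] Space)

lemma space_eq_sum (x : Space) : x = x 0 • EuclideanSpace.single 0 1
    + x 1 • EuclideanSpace.single 1 1 + x 2 • EuclideanSpace.single 2 1 := by
  ext k; fin_cases k <;> simp

lemma linear_apply_frameOf (g : Space ≃ᵃ[ℝ] Space) (x : Space) : g.linear x =
    x 0 • (frameOf g).2.1 + x 1 • (frameOf g).2.2.1 + x 2 • (frameOf g).2.2.2 := by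
  conv_lhs => rw [space_eq_sum x]
  simp only [map_add, map_smul, frameOf]

lemma apply_frameOf (g : Space ≃ᵃ[ℝ] Space) (x : Space) : g x = (frameOf g).1
    + x 0 • (frameOf g).2.1 + x 1 • (frameOf g).2.2.1 + x 2 • (frameOf g).2.2.2 := by
  have h := g.map_vadd 0 x
  rw [linear_apply_frameOf] at h
  simp only [vadd_eq_add, add_zero] at h
  rw [h]
  simp only [frameOf]
  abel

lemma map_axis (g : Space ≃ᵃ[ℝ] Space) :
    axis.map (g : Space →ᵃ[ℝ] Space) = line (frameOf g).core := by
  rw [axis, map_lineThrough]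
  rfl

lemma map_generatrix (g : Space ≃ᵃ[ℝ] Space) (ε : ℤˣ) (θ : Real.Angle) :
    (generatrix ε θ).map (g : Space →ᵃ[ℝ] Space) =
      line ((frameOf g).near (circlePoint 1 ((ε : ℤ) : ℝ) θ)) := by
  rw [generatrix, map_lineThrough, line]
  congr 1
  · change g _ = _
    rw [apply_frameOf]
    simp [Frame.near, circlePoint]
  · change g.linear _ = _
    rw [linear_apply_frameOf]
    simp only [Frame.near, circlePoint, Matrix.cons_val]
    module

/-- The generatrices of the shrunk hyperboloids lie in the original solid hyperboloid. -/
lemma near_line_subset (g : Space ≃ᵃ[ℝ] Space) {s : ℝ} (hs : 0 ≤ s) (hs1 : s ≤ 1) (ε : ℤˣ)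
    (θ : Real.Angle) {x : Space}
    (hx : x ∈ line ((frameOf g).near (circlePoint s ((ε : ℤ) : ℝ) θ))) :
    x ∈ g '' solidHyperboloid := by
  obtain ⟨t, rfl⟩ := mem_lineThrough.1 hx
  refine ⟨!₂[s * (θ.cos - t * ((ε : ℤ) : ℝ) * θ.sin), s * (θ.sin + t * ((ε : ℤ) : ℝ) * θ.cos), t],
    ?_, ?_⟩
  · have hε : ((ε : ℤ) : ℝ) ^ 2 = 1 := by
      rw [← sq_abs, abs_units_cast, one_pow]
    have h1 := Real.Angle.cos_sq_add_sin_sq θ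
    have h2 : s ^ 2 ≤ 1 := pow_le_one₀ hs hs1
    change (s * (θ.cos - t * ((ε : ℤ) : ℝ) * θ.sin)) ^ 2 +
      (s * (θ.sin + t * ((ε : ℤ) : ℝ) * θ.cos)) ^ 2 ≤ 1 + t ^ 2
    calc _ = s ^ 2 * ((θ.cos ^ 2 + θ.sin ^ 2) * (1 + t ^ 2 * ((ε : ℤ) : ℝ) ^ 2)) := by ring
      _ = s ^ 2 * (1 + t ^ 2) := by rw [h1, hε]; ring
      _ ≤ 1 * (1 + t ^ 2) := by gcongr
      _ = _ := one_mul _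
  · rw [apply_frameOf]
    simp only [Frame.near, circlePoint, Matrix.cons_val]
    module

/-- A line whose direction is inside the asymptotic cone meets the solid hyperboloid. -/
lemma exists_mem_solidHyperboloid (p : Space) {u : Space} (hu : u 0 ^ 2 + u 1 ^ 2 < u 2 ^ 2) :
    ∃ t : ℝ, p + t • u ∈ solidHyperboloid := by
  set C := u 2 ^ 2 - u 0 ^ 2 - u 1 ^ 2
  set A := p 0 ^ 2 + p 1 ^ 2 - p 2 ^ 2
  set B := 2 * (p 0 * u 0 + p 1 * u 1 - p 2 * u 2)
  have hC : 0 < C := by simp only [C]; linarith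
  set t := (|A| + |B|) / C + 1
  have ht : 1 ≤ t := le_add_of_nonneg_left (by positivity)
  have hCt : |A| + |B| ≤ C * t := by
    simp only [t, mul_add, mul_div_cancel₀ _ hC.ne']
    linarith
  refine ⟨t, ?_⟩
  have h1 : A + B * t ≤ C * t * t := by
    calc A + B * t ≤ |A| * t + |B| * t := by
          have := abs_nonneg A
          have := mul_le_mul_of_nonneg_right (le_abs_self B) (zero_le_one.trans ht)
          nlinarith [le_abs_self A]
      _ = (|A| + |B|) * t := by ring
      _ ≤ C * t * t := by gcongr
  simp only [solidHyperboloid, mem_ofPred_eq, PiLp.add_apply, PiLp.smul_apply, smul_eq_mul]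
  simp only [A, B, C] at h1
  nlinarith

/-- Generatrices of hyperboloids that bound disjoint regions do not meet, but may be parallel. After
a shrinking of the hyperboloids they are skew: the direction of such a generatrix lies inside the
asymptotic cone, so that every line parallel to it meets its region. -/
lemma pairDet_near_ne_zero_of_disjoint {g g' : Space ≃ᵃ[ℝ] Space} (hg : OrientationPreserving g)
    (hg' : OrientationPreserving g')
    (hd : Disjoint (g '' solidHyperboloid) (g' '' solidHyperboloid)) {s : ℝ} (hs : 0 ≤ s) (hs1 : s < 1) (ε ε' : ℤˣ) (θ θ' : Real.Angle) :
    pairDet ((frameOf g).near (circlePoint s ((ε : ℤ) : ℝ) θ))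
      ((frameOf g').near (circlePoint s ((ε' : ℤ) : ℝ) θ')) ≠ 0 := by
  have hv : 0 < (frameOf g).vol := by rw [vol_frameOf]; exact hg
  have hv' : 0 < (frameOf g').vol := by rw [vol_frameOf]; exact hg'
  rw [← skew_line_iff (Frame.near_direction_ne_zero hv _) (Frame.near_direction_ne_zero hv' _)]
  refine ⟨hd.mono (fun x hx => near_line_subset g hs hs1.le ε θ hx)
    (fun x hx => near_line_subset g' hs hs1.le ε' θ' hx), fun hp => ?_⟩
  have hdir := hp.direction_eq
  set x := (frameOf g).near (circlePoint s ((ε : ℤ) : ℝ) θ) with hx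
  set y := (frameOf g').near (circlePoint s ((ε' : ℤ) : ℝ) θ') with hy
  rw [line, line, direction_lineThrough, direction_lineThrough] at hdir
  obtain ⟨c, hc⟩ := Submodule.mem_span_singleton.1
    (hdir ▸ Submodule.mem_span_singleton_self x.2 : x.2 ∈ Submodule.span ℝ {y.2})
  let u : Space := !₂[-(s * ((ε : ℤ) : ℝ) * θ.sin), s * ((ε : ℤ) : ℝ) * θ.cos, 1]
  have hu : g.linear u = x.2 := by
    rw [linear_apply_frameOf]
    simp only [u, hx, Frame.near, circlePoint, Matrix.cons_val]
    module
  have hcone : u 0 ^ 2 + u 1 ^ 2 < u 2 ^ 2 := by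
    have hε : ((ε : ℤ) : ℝ) ^ 2 = 1 := by
      rw [← sq_abs, abs_units_cast, one_pow]
    have h1 := Real.Angle.cos_sq_add_sin_sq θ
    change (-(s * ((ε : ℤ) : ℝ) * θ.sin)) ^ 2 + (s * ((ε : ℤ) : ℝ) * θ.cos) ^ 2 < 1 ^ 2
    calc _ = s ^ 2 * (((ε : ℤ) : ℝ) ^ 2 * (θ.cos ^ 2 + θ.sin ^ 2)) := by ring
      _ = s ^ 2 := by rw [hε, h1]; ring
      _ < 1 ^ 2 := by gcongr
  obtain ⟨t, ht⟩ := exists_mem_solidHyperboloid (g.symm y.1) hcone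
  have hpt : g (g.symm y.1 + t • u) = y.1 + (t * c) • y.2 := by
    have := g.map_vadd (g.symm y.1) (t • u)
    rw [vadd_eq_add, vadd_eq_add, g.apply_symm_apply, map_smul, hu, ← hc, smul_smul, add_comm,
      add_comm _ y.1] at this
    exact this
  refine disjoint_left.1 hd ⟨_, ht, rfl⟩ ?_
  rw [hpt]
  exact near_line_subset g' hs hs1.le ε' θ' (mem_lineThrough.2 ⟨_, rfl⟩)

lemma isReplacement_iff {X : ι → AffineSubspace ℝ Space} {ε : ι → ℤˣ} {n : ι → ℕ}
    {T : Set (AffineSubspace ℝ Space)} : IsReplacement X ε n T ↔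
      ∃ (g : ι → (Space ≃ᵃ[ℝ] Space)) (Θ : ι → Finset Real.Angle),
        (∀ i, OrientationPreserving (g i)) ∧
        (∀ i, line (frameOf (g i)).core = X i) ∧
        (∀ i j, i ≠ j → Disjoint (g i '' solidHyperboloid) (g j '' solidHyperboloid)) ∧
        (∀ i, (Θ i).card = n i) ∧ T = thinSet (fun i => frameOf (g i)) 1 ε Θ := by
  constructor
  · rintro ⟨g, A, ho, hX, hd, hA, rfl⟩
    choose θ hθ using hA
    refine ⟨g, fun i => Finset.univ.map (θ i), ho, fun i => by rw [← map_axis, hX], hd,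
      fun i => by simp, iUnion_congr fun i => ?_⟩
    rw [hθ i, Finset.coe_map, Finset.coe_univ, image_univ, ← range_comp]
    simp only [map_generatrix]
    rfl
  · rintro ⟨g, Θ, ho, hX, hd, hΘ, rfl⟩
    refine ⟨g, _, ho, fun i => by rw [map_axis, hX], hd, fun i => ?_, rfl⟩
    let e := (Finset.equivFinOfCardEq (hΘ i)).symm
    refine ⟨e.toEmbedding.trans (Function.Embedding.subtype _), ?_⟩
    simp only [map_generatrix]
    rw [image_eq_range]
    exact (EquivLike.range_comp (fun θ : (Θ i) => line ((frameOf (g i)).near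
      (circlePoint 1 ((ε i : ℤ) : ℝ) θ))) e).symm

/-- A replacement whose lines are pairwise skew is isotopic to the thin replacements obtained by
shrinking its hyperboloids. -/
lemma IsReplacement.exists_thinSet [Fintype ι] {X : ι → AffineSubspace ℝ Space} {ε : ι → ℤˣ}
    {n : ι → ℕ} {T : Set (AffineSubspace ℝ Space)} (h : IsReplacement X ε n T)
    (hX : ∀ i j, i ≠ j → Skew (X i) (X j)) (hT : T.Pairwise Skew) :
    ∃ F ∈ FrameConfig ι, ∃ Θ : ι → Finset Real.Angle, (∀ i, line (F i).core = X i) ∧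
      (∀ i, (Θ i).card = n i) ∧ T.encard = ∑ i, n i ∧
      ∀ s, 0 < s → s ≤ 1 → Isotopic T (thinSet F s ε Θ) := by
  obtain ⟨g, Θ, ho, hgX, hd, hΘ, rfl⟩ := isReplacement_iff.1 h
  have hv (i : ι) : 0 < (frameOf (g i)).vol := by rw [vol_frameOf]; exact ho i
  have hv0 (i : ι) : (frameOf (g i)).core.2 ≠ 0 := by
    have := Frame.near_direction_ne_zero (hv i) 0
    rwa [Frame.near_zero] at this
  choose τ hmono hmem hrange using fun i => exists_sorted_angles (Θ i) rfl
  have hconf (s : ℝ) (hs : 0 < s) (hs1 : s ≤ 1) :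
      (fun p : Σ i, Fin (Θ i).card => (frameOf (g p.1)).near
        (circlePoint s ((ε p.1 : ℤ) : ℝ) (τ p.1 p.2))) ∈ Config (Σ i, Fin (Θ i).card) := by
    refine near_mem_config (π := Sigma.fst) hv (fun p q hpq => ?_) ?_
    · rcases hs1.lt_or_eq with hlt | rfl
      · exact pairDet_near_ne_zero_of_disjoint (ho _) (ho _) (hd _ _ hpq) hs.le hlt _ _ _ _
      · rw [← skew_line_iff (Frame.near_direction_ne_zero (hv _) _)
          (Frame.near_direction_ne_zero (hv _) _)]
        rw [thinSet_eq_range hrange] at hT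
        refine hT (mem_range_self p) (mem_range_self q) fun heq => ?_
        have hx : ((frameOf (g p.1)).near (circlePoint 1 ((ε p.1 : ℤ) : ℝ) (τ p.1 p.2))).1 ∈
            line ((frameOf (g p.1)).near (circlePoint 1 ((ε p.1 : ℤ) : ℝ) (τ p.1 p.2))) :=
          mem_lineThrough.2 ⟨0, by simp⟩
        exact disjoint_left.1 (hd _ _ hpq)
          (near_line_subset _ zero_le_one le_rfl _ _ hx)
          (near_line_subset _ zero_le_one le_rfl _ _ (heq ▸ hx))
    · rintro ⟨i, j⟩ ⟨i', j'⟩ hpq (rfl : i = i')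
      rw [Frame.pairDet_near_circlePoint]
      have hj : j ≠ j' := fun h => hpq (by rw [h])
      have hunit : ((ε i : ℤ) : ℝ) ≠ 0 := by
        rw [← abs_pos, abs_units_cast]; exact one_pos
      exact mul_ne_zero (hv i).ne' (mul_ne_zero hunit (mul_pos (pow_pos hs 2)
        (cos_sin_dist_pos (angle_coe_ne (hmem i j) (hmem i j') ((hmono i).injective.ne hj)))).ne')
  refine ⟨fun i => frameOf (g i), ⟨hv, fun i => hv0 i, fun i j hij => ?_⟩, Θ, hgX, hΘ, ?_, ?_⟩
  · rw [← skew_line_iff (hv0 i) (hv0 j), hgX, hgX]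
    exact hX i j hij
  · rw [thinSet_eq_range hrange, ← image_univ,
      (Config.injective (hconf 1 one_pos le_rfl)).encard_image, encard_univ,
      ENat.card_eq_coe_fintype_card, Fintype.card_sigma]
    simp [hΘ]
  · intro s hs hs1
    rw [thinSet_eq_range hrange, thinSet_eq_range hrange]
    refine isotopic_range (isotopicFamilies_of_joinedIn ?_)
    have hj : JoinedIn (Ioc (0 : ℝ) 1) 1 s :=
      ((convex_Ioc 0 1).isPathConnected ⟨s, hs, hs1⟩).joinedIn _ ⟨one_pos, le_rfl⟩ _ ⟨hs, hs1⟩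
    refine (hj.map (f := fun s (p : Σ i, Fin (Θ i).card) => (frameOf (g p.1)).near
        (circlePoint s ((ε p.1 : ℤ) : ℝ) (τ p.1 p.2))) ?_).mono ?_
    · unfold Frame.near circlePoint
      fun_prop
    · rintro _ ⟨s, hs, rfl⟩
      exact hconf s hs.1 hs.2

/-! ### Existence of replacements -/

lemma exists_frameOf_eq {F : Frame} (hF : 0 < F.vol) :
    ∃ g : Space ≃ᵃ[ℝ] Space, OrientationPreserving g ∧ frameOf g = F := by
  let f : Space →ₗ[ℝ] Space :=
    (EuclideanSpace.basisFun (Fin 3) ℝ).toBasis.constr ℝ ![F.2.1, F.2.2.1, F.2.2.2]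
  have hf (i : Fin 3) : f (EuclideanSpace.single i 1) = ![F.2.1, F.2.2.1, F.2.2.2] i := by
    rw [← EuclideanSpace.basisFun_apply, ← OrthonormalBasis.coe_toBasis]
    exact (EuclideanSpace.basisFun (Fin 3) ℝ).toBasis.constr_basis ℝ _ i
  have hdet : LinearMap.det f = F.vol := by
    rw [← vol_map_single, hf, hf, hf]
    rfl
  let e : Space ≃ₗ[ℝ] Space := LinearEquiv.ofIsUnitDet
    (v := (EuclideanSpace.basisFun (Fin 3) ℝ).toBasis)
    (v' := (EuclideanSpace.basisFun (Fin 3) ℝ).toBasis) (f := f)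
    (by rw [LinearMap.det_toMatrix, hdet]; exact IsUnit.mk0 _ hF.ne')
  have he (x : Space) : e x = f x := rfl
  let g : Space ≃ᵃ[ℝ] Space := e.toAffineEquiv.trans (AffineEquiv.constVAdd ℝ Space F.1)
  have hgl : (g.linear : Space →ₗ[ℝ] Space) = f := by
    ext x
    rfl
  refine ⟨g, ?_, ?_⟩
  · rw [OrientationPreserving, hgl, hdet]
    exact hF
  · have h0 : g 0 = F.1 := by
      change F.1 +ᵥ e 0 = F.1
      simp
    have hl (i : Fin 3) : g.linear (EuclideanSpace.single i 1) = ![F.2.1, F.2.2.1, F.2.2.2] i :=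
      hf i
    rw [frameOf, h0, hl, hl, hl]
    rfl

lemma abs_vol_le (u v w : Space) : |vol u v w| ≤ 6 * (‖u‖ * ‖v‖ * ‖w‖) := by
  have h (i j k : Fin 3) : |u i * (v j * w k)| ≤ ‖u‖ * ‖v‖ * ‖w‖ := by
    rw [abs_mul, abs_mul, mul_assoc]
    have hu : |u i| ≤ ‖u‖ := PiLp.norm_apply_le u i
    have hv : |v j| ≤ ‖v‖ := PiLp.norm_apply_le v j
    have hw : |w k| ≤ ‖w‖ := PiLp.norm_apply_le w k
    gcongr
  have e : vol u v w = u 0 * (v 1 * w 2) - u 0 * (v 2 * w 1) - u 1 * (v 0 * w 2)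
      + u 1 * (v 2 * w 0) + u 2 * (v 0 * w 1) - u 2 * (v 1 * w 0) := by
    rw [vol_eq]; ring
  have h1 := abs_le.1 (h 0 1 2)
  have h2 := abs_le.1 (h 0 2 1)
  have h3 := abs_le.1 (h 1 0 2)
  have h4 := abs_le.1 (h 1 2 0)
  have h5 := abs_le.1 (h 2 0 1)
  have h6 := abs_le.1 (h 2 1 0)
  rw [e, abs_le]
  constructor <;> linarith [h1.1, h1.2, h2.1, h2.2, h3.1, h3.2, h4.1, h4.2, h5.1, h5.2, h6.1, h6.2]

/-- The frame with the transversal vectors multiplied by `s`. -/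
noncomputable def Frame.scale (F : Frame) (s : ℝ) : Frame := (F.1, s • F.2.1, s • F.2.2.1, F.2.2.2)

/-- Thin hyperboloids around two skew lines bound disjoint regions. For a common point, Cramer's
rule bounds its coordinates along both lines by a multiple of the radius. -/
lemma exists_disjoint_of_skew {F F' : Frame} (h : pairDet F.core F'.core ≠ 0) :
    ∃ r > 0, ∀ s, 0 < s → s < r → ∀ g g' : Space ≃ᵃ[ℝ] Space, frameOf g = F.scale s →
      frameOf g' = F'.scale s → Disjoint (g '' solidHyperboloid) (g' '' solidHyperboloid) := by
  obtain ⟨a, e, f, v⟩ := F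
  obtain ⟨b, e', f', w⟩ := F'
  simp only [pairDet, Frame.core] at h
  set d := a - b with hd
  set D := vol v w d with hD
  set N := ‖e‖ + ‖f‖ + ‖e'‖ + ‖f'‖ with hN
  set M := ‖v‖ * ‖w‖ + ‖w‖ * ‖d‖ + ‖v‖ * ‖d‖ with hM
  have hN0 : 0 ≤ N := by positivity
  have hM0 : 0 ≤ M := by positivity
  have hDpos : 0 < |D| := abs_pos.2 h
  refine ⟨|D| / (6 * M * N + 1), by positivity, fun s hs hsr g g' hg hg' => ?_⟩
  rw [lt_div_iff₀ (by positivity)] at hsr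
  rw [disjoint_left]
  rintro _ ⟨p, hp, rfl⟩ ⟨q, hq, hpq⟩
  rw [apply_frameOf, apply_frameOf, hg, hg'] at hpq
  simp only [Frame.scale] at hpq
  simp only [solidHyperboloid, mem_ofPred_eq] at hp hq
  set m := 1 + |p 2| + |q 2| with hm
  have hp2 := abs_nonneg (p 2)
  have hq2 := abs_nonneg (q 2)
  have hbound {x y z : ℝ} (hxy : x ^ 2 + y ^ 2 ≤ 1 + z ^ 2) : |x| ≤ 1 + |z| := by
    apply abs_le_of_sq_le_sq' _ (by positivity) |> abs_le.2
    nlinarith [sq_abs z, abs_nonneg z, sq_nonneg y]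
  have hp0 : |p 0| ≤ m := (hbound hp).trans (by linarith)
  have hp1 : |p 1| ≤ m := (hbound (by rwa [add_comm] at hp)).trans (by linarith)
  have hq0 : |q 0| ≤ m := (hbound hq).trans (by linarith)
  have hq1 : |q 1| ≤ m := (hbound (by rwa [add_comm] at hq)).trans (by linarith)
  set x : Space := q 0 • e' + q 1 • f' - p 0 • e - p 1 • f with hx
  have hxn : ‖x‖ ≤ m * N := by
    calc ‖x‖ ≤ ‖q 0 • e'‖ + ‖q 1 • f'‖ + ‖p 0 • e‖ + ‖p 1 • f‖ :=
          (norm_sub_le _ _).trans (add_le_add ((norm_sub_le _ _).trans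
            (add_le_add (norm_add_le _ _) le_rfl)) le_rfl)
      _ = |q 0| * ‖e'‖ + |q 1| * ‖f'‖ + |p 0| * ‖e‖ + |p 1| * ‖f‖ := by
          simp only [norm_smul, Real.norm_eq_abs]
      _ ≤ m * ‖e'‖ + m * ‖f'‖ + m * ‖e‖ + m * ‖f‖ := by gcongr
      _ = m * N := by rw [hN]; ring
  have hrel : d + p 2 • v - q 2 • w = s • x := by
    have : d + p 2 • v - q 2 • w - s • x = (a + p 0 • s • e + p 1 • s • f + p 2 • v)
        - (b + q 0 • s • e' + q 1 • s • f' + q 2 • w) := by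
      rw [hd, hx]; module
    rw [← hpq, sub_self] at this
    exact sub_eq_zero.1 this
  have hsmul (y z : Space) : vol y z (s • x) = s * vol y z x ∧ vol (s • x) y z = s * vol x y z ∧
      vol y (s • x) z = s * vol y x z := by
    simp only [vol_eq, PiLp.smul_apply, smul_eq_mul]
    refine ⟨?_, ?_, ?_⟩ <;> ring
  have h1 : D = s * vol v w x := by
    rw [← (hsmul v w).1, ← hrel, hD]
    simp only [vol_eq, PiLp.add_apply, PiLp.sub_apply, PiLp.smul_apply, smul_eq_mul]; ring
  have h2 : p 2 * D = s * vol x w d := by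
    rw [← (hsmul w d).2.1, ← hrel, hD]
    simp only [vol_eq, PiLp.add_apply, PiLp.sub_apply, PiLp.smul_apply, smul_eq_mul]; ring
  have h3 : q 2 * D = -(s * vol v x d) := by
    rw [← (hsmul v d).2.2, ← hrel, hD]
    simp only [vol_eq, PiLp.add_apply, PiLp.sub_apply, PiLp.smul_apply, smul_eq_mul]; ring
  have h1' : |D| = s * |vol v w x| := by
    conv_lhs => rw [h1, abs_mul, abs_of_pos hs]
  have h2' : |p 2| * |D| = s * |vol x w d| := by
    rw [← abs_mul, h2, abs_mul, abs_of_pos hs]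
  have h3' : |q 2| * |D| = s * |vol v x d| := by
    rw [← abs_mul, h3, abs_neg, abs_mul, abs_of_pos hs]
  have hsum : m * |D| ≤ s * (6 * M * ‖x‖) := by
    calc m * |D| = s * (|vol v w x| + |vol x w d| + |vol v x d|) := by
          rw [hm, add_mul, add_mul, one_mul, h2', h3', h1']; ring
      _ ≤ s * (6 * (‖v‖ * ‖w‖ * ‖x‖) + 6 * (‖x‖ * ‖w‖ * ‖d‖) + 6 * (‖v‖ * ‖x‖ * ‖d‖)) := by
          gcongr <;> exact abs_vol_le _ _ _
      _ = s * (6 * M * ‖x‖) := by rw [hM]; ring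
  have hm0 : 0 < m := by positivity
  have hle : m * |D| ≤ m * (s * (6 * M * N)) :=
    hsum.trans (by
      calc s * (6 * M * ‖x‖) ≤ s * (6 * M * (m * N)) := by gcongr
        _ = _ := by ring)
  have := le_of_mul_le_mul_left hle hm0
  linarith

instance : Infinite Real.Angle := by
  have : Infinite (Ioc (-Real.pi) Real.pi) :=
    Set.infinite_coe_iff.2 (Ioc_infinite (by linarith [Real.pi_pos]))
  refine Infinite.of_injective (fun x : Ioc (-Real.pi) Real.pi => ((x : ℝ) : Real.Angle))
    fun x y h => ?_
  by_contra hne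
  exact angle_coe_ne x.2 y.2 (fun h => hne (Subtype.ext h)) h

/-- Any pairwise skew lines can be replaced by generatrices of thin hyperboloids around them. -/
lemma exists_isReplacement [Finite ι] {X : ι → AffineSubspace ℝ Space} (hX : ∀ i, IsLine (X i))
    (hs : ∀ i j, i ≠ j → Skew (X i) (X j)) (ε : ι → ℤˣ) (n : ι → ℕ) :
    ∃ T, IsReplacement X ε n T ∧ Isotopic T T := by
  obtain ⟨x, hx, hxX⟩ := exists_config hX hs
  obtain ⟨F, hF, hcore⟩ := exists_frameConfig hx
  choose Θ hΘ using fun i => Infinite.exists_subset_card_eq Real.Angle (n i)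
  obtain ⟨r, hr, H⟩ := isotopic_thinSet hF hF (ε := ε) (ε' := ε) (Θ := Θ) (Θ' := Θ)
    (isotopicFamilies_refl hF.2 fun _ => rfl) (fun _ => rfl) fun _ => Or.inl rfl
  have hd : ∀ᶠ s in 𝓝[>] (0 : ℝ), ∀ i j, i ≠ j → ∀ g g' : Space ≃ᵃ[ℝ] Space,
      frameOf g = (F i).scale s → frameOf g' = (F j).scale s →
        Disjoint (g '' solidHyperboloid) (g' '' solidHyperboloid) := by
    simp only [Filter.eventually_all]
    intro i j hij
    obtain ⟨r, hr, H⟩ := exists_disjoint_of_skew (hF.2.2 i j hij)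
    filter_upwards [Ioo_mem_nhdsGT hr] with s hs
    exact H s hs.1 hs.2
  obtain ⟨s, hs, hs0, hsr⟩ := (hd.and (Ioo_mem_nhdsGT hr)).exists
  have hscale (i : ι) : 0 < ((F i).scale s).vol := by
    have : ((F i).scale s).vol = s ^ 2 * (F i).vol := by
      simp only [Frame.scale, Frame.vol, vol_eq, PiLp.smul_apply, smul_eq_mul]; ring
    rw [this]
    exact mul_pos (pow_pos hs0 2) (hF.1 i)
  choose g hg hgF using fun i => exists_frameOf_eq (hscale i)
  refine ⟨thinSet F s ε Θ, isReplacement_iff.2 ⟨g, Θ, hg, fun i => ?_, fun i j hij =>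
    hs i j hij _ _ (hgF i) (hgF j), hΘ, iUnion_congr fun i => ?_⟩, H s hs0 hsr⟩
  · rw [hgF, ← hxX, ← hcore]
    rfl
  · refine image_congr fun θ _ => ?_
    simp only [hgF]
    congr 1
    simp only [Frame.near, Frame.scale, circlePoint, smul_smul, Prod.mk.injEq]
    constructor <;> module

/-! ### Mirror images -/

lemma mirror_apply (x : Space) : mirror x = !₂[x 0, x 1, -x 2] := by
  rw [mirror, Submodule.reflection_orthogonal_apply, Submodule.reflection_singleton_apply]
  ext k
  fin_cases k <;> simp [EuclideanSpace.inner_single_left]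
  ring

/-- The mirror image of a line. -/
noncomputable def mirrorLine (L : AffineSubspace ℝ Space) : AffineSubspace ℝ Space :=
  L.map mirror.toLinearEquiv.toLinearMap.toAffineMap

/-- The mirror image of a pointed directed line. -/
noncomputable def mirrorData (x : Space × Space) : Space × Space := (mirror x.1, mirror x.2)

lemma mirrorLine_line (x : Space × Space) : mirrorLine (line x) = line (mirrorData x) := by
  rw [mirrorLine, line, map_lineThrough]
  rfl

lemma pairDet_mirrorData (x y : Space × Space) :
    pairDet (mirrorData x) (mirrorData y) = -pairDet x y := by
  simp only [pairDet, mirrorData, mirror_apply, vol_eq, PiLp.sub_apply, Matrix.cons_val]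
  ring

lemma Config.mirror {x : ι → Space × Space} (hx : x ∈ Config ι) :
    (fun i => mirrorData (x i)) ∈ Config ι := by
  refine ⟨fun i h => hx.1 i (_root_.mirror.map_eq_zero_iff.1 h), fun i j hij => ?_⟩
  rw [pairDet_mirrorData]
  exact neg_ne_zero.2 (hx.2 i j hij)

lemma IsotopicFamilies.mirror {L M : ι → AffineSubspace ℝ Space} (h : IsotopicFamilies L M) :
    IsotopicFamilies (fun i => mirrorLine (L i)) fun i => mirrorLine (M i) := by
  obtain ⟨x, y, hj, hL, hM⟩ := isotopicFamilies_iff.1 h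
  refine isotopicFamilies_iff.2 ⟨fun i => mirrorData (x i), fun i => mirrorData (y i),
    (hj.map (f := fun (z : ι → Space × Space) i => mirrorData (z i)) ?_).mono ?_,
    fun i => by rw [← hL, mirrorLine_line], fun i => by rw [← hM, mirrorLine_line]⟩
  · have := _root_.mirror.continuous
    unfold mirrorData
    fun_prop
  · rintro _ ⟨z, hz, rfl⟩
    exact Config.mirror hz

lemma mirrorImage_range {κ : Type} (L : κ → AffineSubspace ℝ Space) :
    mirrorImage (range L) = range fun i => mirrorLine (L i) :=
  (range_comp _ _).symm

lemma Isotopic.mirrorImage {S T : Set (AffineSubspace ℝ Space)} (h : Isotopic S T) :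
    Isotopic (mirrorImage S) (mirrorImage T) := by
  obtain ⟨n, L, M, rfl, rfl, h⟩ := h
  rw [mirrorImage_range, mirrorImage_range]
  exact isotopic_range h.mirror

lemma Isotopic.amphicheiral {S T : Set (AffineSubspace ℝ Space)} (h : Isotopic S T)
    (hT : Amphicheiral T) : Amphicheiral S :=
  (h.trans hT).trans h.mirrorImage.symm

/-- The mirror image of a frame, rotated so as to be positively oriented. -/
noncomputable def Frame.mirror (F : Frame) : Frame :=
  (_root_.mirror F.1, _root_.mirror F.2.1, _root_.mirror F.2.2.1, -_root_.mirror F.2.2.2)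

lemma Frame.vol_mirror (F : Frame) : F.mirror.vol = F.vol := by
  simp only [Frame.mirror, Frame.vol, mirror_apply, vol_eq, PiLp.neg_apply, Matrix.cons_val]
  ring

lemma Frame.line_core_mirror (F : Frame) : line F.mirror.core = mirrorLine (line F.core) := by
  rw [mirrorLine_line, ← line_reparam (c := -1) (by norm_num) 0]
  simp [Frame.mirror, Frame.core, reparam, mirrorData]

/-- Reflections change the sign of a family of generatrices. -/
lemma Frame.line_near_mirror (F : Frame) (s ε : ℝ) (θ : Real.Angle) :
    line (F.mirror.near (circlePoint s (-ε) θ)) =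
      mirrorLine (line (F.near (circlePoint s ε θ))) := by
  rw [mirrorLine_line, ← line_reparam (c := -1) (by norm_num) 0 (mirrorData _)]
  congr 1
  simp only [Frame.near, Frame.mirror, circlePoint, reparam, mirrorData, Prod.mk.injEq, map_add,
    map_smul]
  constructor <;> module

/-- A replacement is amphicheiral if the family of core lines is isotopic to its mirror image by an
isotopy that permutes the labels so as to reverse the signs. -/
lemma IsReplacement.amphicheiral [Fintype ι] {X : ι → AffineSubspace ℝ Space} {ε : ι → ℤˣ}
    {n : ι → ℕ} {T : Set (AffineSubspace ℝ Space)} (h : IsReplacement X ε n T)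
    (hT : T.Pairwise Skew) (π : Equiv.Perm ι)
    (hX : IsotopicFamilies X fun i => mirrorLine (X (π i)))
    (hn : ∀ i, n (π i) = n i) (hε : ∀ i, ε i = -ε (π i) ∨ n i ≤ 1) : Amphicheiral T := by
  obtain ⟨x, hx, hxX⟩ := hX.exists_config_left
  obtain ⟨F, hF, Θ, hFX, hΘ, -, hthin⟩ := h.exists_thinSet
    (fun i j hij => by rw [← hxX, ← hxX]; exact Config.skew hx hij) hT
  have hF' : (fun i => (F (π i)).mirror) ∈ FrameConfig ι := by
    refine ⟨fun i => by rw [Frame.vol_mirror]; exact hF.1 _, ?_⟩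
    have hc : (fun i => (F (π i)).mirror.core) =
        fun i => reparam (-1) 0 (mirrorData (F (π i)).core) := by
      funext i
      simp [Frame.mirror, Frame.core, reparam, mirrorData]
    rw [hc]
    exact Config.reparam (Config.mirror (Config.comp hF.2 π.injective)) _ fun _ => by norm_num
  obtain ⟨r, hr, H⟩ := isotopic_thinSet hF hF' (ε := ε) (ε' := fun i => -ε (π i)) (Θ := Θ)
    (Θ' := fun i => Θ (π i))
    (by simpa only [Frame.line_core_mirror, hFX] using hX)
    (fun i => by rw [hΘ, hΘ, hn]) (fun i => by rw [hΘ]; exact hε i)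
  have hmir (s : ℝ) : thinSet (fun i => (F (π i)).mirror) s (fun i => -ε (π i))
      (fun i => Θ (π i)) = mirrorImage (thinSet F s ε Θ) := by
    rw [thinSet, thinSet, mirrorImage, image_iUnion]
    refine iUnion_congr_of_surjective π π.surjective fun i => ?_
    rw [image_image]
    refine image_congr fun θ _ => ?_
    have := Frame.line_near_mirror (F (π i)) s ((ε (π i) : ℤ) : ℝ) θ
    push_cast
    exact this.symm
  have hs : 0 < min 1 (r / 2) := by positivity
  have h1 := hthin _ hs (min_le_left _ _)
  have h2 := H _ hs ((min_le_right _ _).trans_lt (by linarith))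
  rw [hmir] at h2
  exact (h1.trans h2).trans h1.mirrorImage.symm

/-! ### Replacements of a pair of skew lines -/

lemma IsLine.mirrorLine {L : AffineSubspace ℝ Space} (h : IsLine L) : IsLine (mirrorLine L) := by
  obtain ⟨a, v, hv, rfl⟩ := isLine_iff.1 h
  rw [show lineThrough a v = line (a, v) from rfl, mirrorLine_line]
  exact isLine_lineThrough _ fun h => hv (mirror.map_eq_zero_iff.1 h)

lemma Skew.mirrorLine {L M : AffineSubspace ℝ Space} (hL : IsLine L) (hM : IsLine M)
    (h : Skew L M) : Skew (mirrorLine L) (mirrorLine M) := by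
  obtain ⟨a, v, hv, rfl⟩ := isLine_iff.1 hL
  obtain ⟨b, w, hw, rfl⟩ := isLine_iff.1 hM
  have h1 : pairDet (a, v) (b, w) ≠ 0 := (skew_lineThrough_iff hv hw).1 h
  rw [show lineThrough a v = line (a, v) from rfl, show lineThrough b w = line (b, w) from rfl,
    mirrorLine_line, mirrorLine_line]
  refine (skew_line_iff ?_ ?_).2 (by rw [pairDet_mirrorData]; exact neg_ne_zero.2 h1)
  · exact fun h => hv (mirror.map_eq_zero_iff.1 h)
  · exact fun h => hw (mirror.map_eq_zero_iff.1 h)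

lemma skew_fin_two {X : Fin 2 → AffineSubspace ℝ Space} (h : Skew (X 0) (X 1)) (i j : Fin 2)
    (hij : i ≠ j) : Skew (X i) (X j) := by
  fin_cases i <;> fin_cases j <;> first | exact absurd rfl hij | exact h | exact h.symm

lemma pairwise_skew_of_isotopic {S T : Set (AffineSubspace ℝ Space)} (h : Isotopic S T) :
    T.Pairwise Skew := by
  obtain ⟨n, L, M, rfl, rfl, h⟩ := h
  obtain ⟨x, hx, hM⟩ := h.symm.exists_config_left
  rintro _ ⟨i, rfl⟩ _ ⟨j, rfl⟩ hij
  rw [← hM, ← hM]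
  exact Config.skew hx fun h => hij (by rw [h])

lemma exists_isDoubleHyperboloidal (m : ℕ) : ∃ S, IsDoubleHyperboloidal m S := by
  let x : Fin 2 → Space × Space := ![(!₂[0, 0, 1], !₂[1, 0, 0]), (0, !₂[0, 1, 0])]
  have hd : pairDet (x 0) (x 1) ≠ 0 := by
    simp [x, pairDet, vol_eq]
  have h0 := ne_zero_of_vol_ne_zero hd
  have hL (i : Fin 2) : IsLine (line (x i)) := by
    fin_cases i
    · exact isLine_lineThrough _ h0.1
    · exact isLine_lineThrough _ h0.2
  have hs : Skew (line (x 0)) (line (x 1)) := (skew_line_iff h0.1 h0.2).2 hd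
  obtain ⟨T, hT, hTT⟩ := exists_isReplacement hL
    (skew_fin_two (X := fun i => line (x i)) hs) ![1, -1] ![m, m]
  exact ⟨T, _, T, hL, hs, hT, hTT⟩

lemma IsDoubleHyperboloidal.isInterlacing_and_amphicheiral {m : ℕ}
    {S : Set (AffineSubspace ℝ Space)} (h : IsDoubleHyperboloidal m S) :
    IsInterlacing (m + m) S ∧ Amphicheiral S := by
  obtain ⟨X, T, hL, hs, hT, hST⟩ := h
  have hsk := pairwise_skew_of_isotopic hST
  constructor
  · obtain ⟨F, hF, Θ, -, -, hcard, -⟩ := hT.exists_thinSet (skew_fin_two hs) hsk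
    refine hST.isInterlacing ?_
    rw [hcard, Fin.sum_univ_two]
    rfl
  · refine hST.amphicheiral (hT.amphicheiral hsk (Equiv.swap 0 1)
      (isotopicFamilies_pair hL hs (fun i => (hL _).mirrorLine) ?_) ?_ ?_)
    · simpa using hs.symm.mirrorLine (hL 1) (hL 0)
    · intro i; fin_cases i <;> simp
    · intro i; fin_cases i <;> simp

/-! ### The five-line example -/

/-- Homogeneous coordinates of five points of the projective line that turn by two steps of the
cyclic order, from `1, 2, 3, 4, 5` at time `0` to `0, 1, 2, -2, -1` at time `1`: numerators. -/
noncomputable def turnNum (t : ℝ) : Fin 5 → ℝ := ![1 - t, 2 - t, 3 - t, 4 - 2 * t, 5 - 3 * t]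

/-- The denominators that belong to `turnNum`. -/
noncomputable def turnDen (t : ℝ) : Fin 5 → ℝ := ![1, 1, 1, 1 - 2 * t, 1 - 3 * t]

/-- The five turning points are distinct at all times. -/
lemma turn_ne {t : ℝ} (ht : t ∈ Icc (0 : ℝ) 1) {i j : Fin 5} (hij : i ≠ j) :
    turnNum t i * turnDen t j - turnNum t j * turnDen t i ≠ 0 := by
  have h0 := ht.1
  have h1 := sub_nonneg.2 ht.2
  have key : ∀ i j : Fin 5, i < j →
      turnNum t i * turnDen t j - turnNum t j * turnDen t i < 0 := by
    intro i j h
    fin_cases i <;> fin_cases j <;> first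
      | exact absurd h (by decide)
      | (simp only [turnNum, turnDen, Fin.zero_eta, Fin.mk_one, Fin.reduceFinMk, Matrix.cons_val]
         nlinarith [mul_nonneg h0 h1])
  rcases lt_or_gt_of_ne hij with h | h
  · exact (key i j h).ne
  · have := key j i h
    intro h'
    linarith

lemma continuous_turn (i : Fin 5) :
    Continuous (fun t => turnNum t i) ∧ Continuous fun t => turnDen t i := by
  constructor <;> fin_cases i <;> simp only [turnNum, turnDen, Fin.zero_eta, Fin.mk_one,
    Fin.reduceFinMk, Matrix.cons_val] <;> fun_prop

lemma turnDen_zero (i : Fin 5) : turnDen 0 i = 1 := by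
  fin_cases i <;> simp [turnDen]

lemma turnDen_one_ne_zero (i : Fin 5) : turnDen 1 i ≠ 0 := by
  fin_cases i <;> norm_num [turnDen]

lemma continuous_vec3 {f g h : ℝ → ℝ} (hf : Continuous f) (hg : Continuous g)
    (hh : Continuous h) : Continuous fun t => (!₂[f t, g t, h t] : Space) := by
  refine (PiLp.continuous_toLp 2 _).comp (continuous_pi fun i => ?_)
  fin_cases i
  · exact hf
  · exact hg
  · exact hh

lemma config_of_pairDet_ne_zero {x : Fin 5 → Space × Space}
    (h : ∀ i j, i ≠ j → pairDet (x i) (x j) ≠ 0) : x ∈ Config (Fin 5) := by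
  refine ⟨fun i => ?_, h⟩
  obtain ⟨j, hj⟩ := exists_ne i
  exact (ne_zero_of_vol_ne_zero (h i j hj.symm)).1

/-- The first parameters of five joining lines turn cyclically by two steps. A line whose first
parameter passes through infinity becomes parallel to the first axis at that moment. -/
lemma isotopicFamilies_turn_left {o : Fin 5 → Fin 5} (ho : Function.Injective o) {y : Fin 5 → ℝ}
    (hy : Function.Injective y) : IsotopicFamilies (fun i => join (turnNum 0 (o i)) (y i))
      fun i => join (turnNum 1 (o i) / turnDen 1 (o i)) (y i) := by
  refine isotopicFamilies_iff.2 ⟨_, _, JoinedIn.ofLine (f := fun t i => ((!₂[0, y i, 1],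
    !₂[-turnNum t (o i), turnDen t (o i) * y i, turnDen t (o i)]) : Space × Space))
    ?_ rfl rfl ?_, fun i => ?_, fun i => ?_⟩
  · refine (continuous_pi fun i => continuous_const.prodMk ?_).continuousOn
    obtain ⟨h1, h2⟩ := continuous_turn (o i)
    exact continuous_vec3 h1.neg (h2.mul continuous_const) h2
  · rintro _ ⟨t, ht, rfl⟩
    refine config_of_pairDet_ne_zero fun i j hij => ?_
    have := mul_ne_zero (turn_ne ht (ho.ne hij)) (sub_ne_zero.2 (hy.ne hij))
    convert this using 1
    simp only [pairDet, vol_eq, PiLp.sub_apply, Matrix.cons_val]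
    ring
  · refine lineThrough_eq_of_eq (c := 1) (d := 1) one_ne_zero ?_ ?_ <;> ext k <;> fin_cases k <;>
      simp [turnDen_zero]
  · have h := turnDen_one_ne_zero (o i)
    refine lineThrough_eq_of_eq (c := turnDen 1 (o i)) (d := 1) h ?_ ?_ <;> ext k <;>
      fin_cases k <;> simp [mul_div_cancel₀, h]

/-- The second parameters of five joining lines turn cyclically by two steps. -/
lemma isotopicFamilies_turn_right {o : Fin 5 → Fin 5} (ho : Function.Injective o) {x : Fin 5 → ℝ}
    (hx : Function.Injective x) : IsotopicFamilies (fun i => join (x i) (turnNum 0 (o i)))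
      fun i => join (x i) (turnNum 1 (o i) / turnDen 1 (o i)) := by
  refine isotopicFamilies_iff.2 ⟨_, _, JoinedIn.ofLine (f := fun t i => ((!₂[x i, 0, 0],
    !₂[-(turnDen t (o i) * x i), turnNum t (o i), turnDen t (o i)]) : Space × Space))
    ?_ rfl rfl ?_, fun i => ?_, fun i => ?_⟩
  · refine (continuous_pi fun i => continuous_const.prodMk ?_).continuousOn
    obtain ⟨h1, h2⟩ := continuous_turn (o i)
    exact continuous_vec3 (h2.mul continuous_const).neg h1 h2
  · rintro _ ⟨t, ht, rfl⟩
    refine config_of_pairDet_ne_zero fun i j hij => ?_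
    have := mul_ne_zero (turn_ne ht (ho.ne hij)) (sub_ne_zero.2 (hx.ne hij))
    convert this using 1
    simp only [pairDet, vol_eq, PiLp.sub_apply, Matrix.cons_val]
    ring
  · refine lineThrough_eq_of_eq (c := 1) (d := 0) one_ne_zero ?_ ?_ <;> ext k <;> fin_cases k <;>
      simp [turnDen_zero]
  · have h := turnDen_one_ne_zero (o i)
    refine lineThrough_eq_of_eq (c := turnDen 1 (o i)) (d := 0) h ?_ ?_ <;> ext k <;>
      fin_cases k <;> simp [mul_div_cancel₀, h]

/-- The joining lines with parameters `(x, y)` are isotopic to the mirror images of those with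
parameters `(-y, x)`. The matrix with rows `p`, `q` stands for the line through `(p, 0)` with
direction `(q, 1)`; the determinant of a difference of two such matrices is that of the two lines.
It is kept by the multiplication with rotation matrices from both sides, which leads from the
diagonal matrix with entries `x`, `y` to that with entries `-y`, `-x`, and by adding multiples of
`p` to `q`. -/
lemma isotopicFamilies_quarter_turn {x y : Fin 5 → ℝ} (hx : Function.Injective x)
    (hy : Function.Injective y) : IsotopicFamilies (fun i => join (x i) (y i))
      fun i => mirrorLine (join (-y i) (x i)) := by
  let c : ℝ → ℝ := fun t => Real.cos (Real.pi / 2 * t)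
  let s : ℝ → ℝ := fun t => Real.sin (Real.pi / 2 * t)
  have hc : Continuous c := by fun_prop
  have hs : Continuous s := by fun_prop
  let p₀ : ℝ → Fin 5 → ℝ := fun t i => c t ^ 2 * x i - s t ^ 2 * y i
  let p₁ : ℝ → Fin 5 → ℝ := fun t i => -(c t * s t * (x i + y i))
  let q₀ : ℝ → Fin 5 → ℝ := fun t i => c t * s t * (x i + y i)
  let q₁ : ℝ → Fin 5 → ℝ := fun t i => c t ^ 2 * y i - s t ^ 2 * x i
  refine isotopicFamilies_iff.2 ⟨_, _, JoinedIn.ofLine (f := fun t i => ((!₂[p₀ t i, p₁ t i, 0],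
    !₂[q₀ t i + (2 * t - 1) * p₀ t i, q₁ t i + (2 * t - 1) * p₁ t i, 1]) : Space × Space))
    ?_ rfl rfl ?_, fun i => ?_, fun i => ?_⟩
  · refine (continuous_pi fun i => Continuous.prodMk ?_ ?_).continuousOn <;>
      exact continuous_vec3 (by fun_prop) (by fun_prop) (by fun_prop)
  · rintro _ ⟨t, ht, rfl⟩
    refine config_of_pairDet_ne_zero fun i j hij => ?_
    have := mul_ne_zero (sub_ne_zero.2 (hx.ne hij)) (sub_ne_zero.2 (hy.ne hij))
    have h1 : c t ^ 2 + s t ^ 2 = 1 := Real.cos_sq_add_sin_sq _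
    have h2 : (x i - x j) * (y i - y j) =
        (x i - x j) * (y i - y j) * (c t ^ 2 + s t ^ 2) ^ 2 := by rw [h1]; ring
    rw [h2] at this
    convert this using 1
    simp only [pairDet, vol_eq, PiLp.sub_apply, Matrix.cons_val, p₀, p₁, q₀, q₁]
    ring
  · refine lineThrough_eq_of_eq (c := 1) (d := 0) one_ne_zero ?_ ?_ <;> ext k <;> fin_cases k <;>
      simp [p₀, p₁, q₀, q₁, c, s]
  · rw [join, show lineThrough _ _ = line (_, _) from rfl, mirrorLine_line]
    refine lineThrough_eq_of_eq (c := -1) (d := 0) (by norm_num) ?_ ?_ <;> ext k <;>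
      fin_cases k <;> simp [mirrorData, mirror_apply, p₀, p₁, q₀, q₁, c, s]
    norm_num

/-- The permutation of the labels of the five-line example induced by its symmetry: it interchanges
the two pairs. -/
def fivePerm : Equiv.Perm (Fin 5) where
  toFun := ![2, 3, 1, 0, 4]
  invFun := ![3, 2, 0, 1, 4]
  left_inv i := by fin_cases i <;> rfl
  right_inv i := by fin_cases i <;> rfl

/-- Modulo `5` the example consists of the points `(x, 2 x)`, a set that is invariant under the
quarter turn `(x, y) ↦ (-y, x)` about each of its points. After cyclic turns that bring the
parameters of the fifth line to `(0, 0)`, this quarter turn preserves the family; it reverses the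
orientation. -/
lemma isotopicFamilies_fiveLines :
    IsotopicFamilies fiveLines fun i => mirrorLine (fiveLines (fivePerm i)) := by
  -- The ranks of the two parameters of the lines.
  let o : Fin 5 → Fin 5 := ![2, 3, 1, 4, 0]
  let o' : Fin 5 → Fin 5 := ![4, 1, 2, 3, 0]
  have ho : Function.Injective o := by decide
  have ho' : Function.Injective o' := by decide
  let z : Fin 5 → ℝ := fun k => turnNum 1 k / turnDen 1 k
  have hz : z = ![0, 1, 2, -2, -1] := by
    funext k; fin_cases k <;> norm_num [z, turnNum, turnDen]
  have hzi : Function.Injective z := by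
    intro i j h
    rw [hz] at h
    fin_cases i <;> fin_cases j <;> first | rfl | norm_num at h
  have h0 : turnNum 0 = ![1, 2, 3, 4, 5] := by
    funext k; fin_cases k <;> norm_num [turnNum]
  have h0i : Function.Injective (turnNum 0) := by
    intro i j h
    rw [h0] at h
    fin_cases i <;> fin_cases j <;> first | rfl | norm_num at h
  have hfive : fiveLines = fun i => join (turnNum 0 (o i)) (turnNum 0 (o' i)) := by
    rw [h0]
    funext i; fin_cases i <;> rfl
  have h1 : IsotopicFamilies fiveLines fun i => join (z (o i)) (z (o' i)) := by
    rw [hfive]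
    exact (isotopicFamilies_turn_left ho (h0i.comp ho')).trans
      (isotopicFamilies_turn_right ho' (hzi.comp ho))
  have h2 := isotopicFamilies_quarter_turn (hzi.comp ho) (hzi.comp ho')
  have h3 : (fun i => mirrorLine (join (-(z ∘ o') i) ((z ∘ o) i))) =
      fun i => mirrorLine (join (z (o (fivePerm i))) (z (o' (fivePerm i)))) := by
    funext i
    rw [hz]
    fin_cases i <;> simp [o, o', fivePerm]
  rw [h3] at h2
  exact (h1.trans h2).trans (h1.symm.mirror.comp fivePerm.injective)

lemma exists_isFiveLineReplacement (δ : ℤˣ) (k : ℕ) : ∃ S, IsFiveLineReplacement δ k S := by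
  obtain ⟨x, hx, hxL⟩ := isotopicFamilies_fiveLines.exists_config_left
  obtain ⟨T, hT, hTT⟩ := exists_isReplacement (X := fiveLines)
    (fun i => by rw [← hxL]; exact isLine_lineThrough _ (hx.1 i))
    (fun i j hij => by rw [← hxL, ← hxL]; exact Config.skew hx hij)
    ![δ, δ, -δ, -δ, 1] ![k, k, k, k, 1]
  exact ⟨T, fiveLines, T, isotopicFamilies_refl hx hxL, hT, hTT⟩

lemma IsFiveLineReplacement.isInterlacing_and_amphicheiral {δ : ℤˣ} {k : ℕ}
    {S : Set (AffineSubspace ℝ Space)} (h : IsFiveLineReplacement δ k S) :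
    IsInterlacing (4 * k + 1) S ∧ Amphicheiral S := by
  obtain ⟨X, T, hX, hT, hST⟩ := h
  have hsk := pairwise_skew_of_isotopic hST
  constructor
  · obtain ⟨x, hx, hxX⟩ := hX.symm.exists_config_left
    obtain ⟨F, hF, Θ, -, -, hcard, -⟩ := hT.exists_thinSet
      (fun i j hij => by rw [← hxX, ← hxX]; exact Config.skew hx hij) hsk
    refine hST.isInterlacing ?_
    rw [hcard, Fin.sum_univ_five]
    norm_cast
    simp only [Matrix.cons_val]
    ring
  · refine hST.amphicheiral (hT.amphicheiral hsk fivePerm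
      ((hX.symm.trans isotopicFamilies_fiveLines).trans
        (hX.mirror.comp fivePerm.injective)) ?_ ?_)
    · intro i; fin_cases i <;> simp [fivePerm]
    · intro i; fin_cases i <;> simp [fivePerm]

/-! ### Linking numbers as isotopy invariants -/

lemma sign_pairDet_eq {x y : ι → Space × Space} (h : JoinedIn (Config ι) x y) {i j : ι}
    (hij : i ≠ j) :
    SignType.sign (pairDet (x i) (x j)) = SignType.sign (pairDet (y i) (y j)) := by
  have key {x y : ι → Space × Space} (h : JoinedIn (Config ι) x y)
      (hx : 0 < pairDet (x i) (x j)) : 0 < pairDet (y i) (y j) := by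
    by_contra! hy
    obtain ⟨γ, hγ⟩ := h
    have hcont : Continuous fun t => pairDet (γ t i) (γ t j) :=
      continuous_pairDet.comp (f := fun t => (γ t i, γ t j)) (by fun_prop)
    obtain ⟨t, ht⟩ := mem_range_of_exists_le_of_exists_ge hcont (c := 0)
      ⟨1, by simpa using hy⟩ ⟨0, by simpa using hx.le⟩
    exact (hγ t).2 i j hij ht
  rcases (h.source_mem.2 i j hij).lt_or_gt with hx | hx
  · have hy : pairDet (y i) (y j) < 0 := by
      refine lt_of_le_of_ne (not_lt.1 fun hy => ?_) (h.target_mem.2 i j hij)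
      exact lt_asymm hx (key h.symm hy)
    rw [sign_neg hx, sign_neg hy]
  · rw [sign_pos hx, sign_pos (key h hx)]

lemma sign_pairDet_reparam (c d c' d' : ℝ) (x y : Space × Space) :
    SignType.sign (pairDet (reparam c d x) (reparam c' d' y)) =
      SignType.sign c * SignType.sign c' * SignType.sign (pairDet x y) := by
  rw [pairDet_reparam, sign_mul, sign_mul]

/-- An isotopy to the mirror image permutes the lines and changes all linking numbers, up to
changes of the orientations of the lines. -/
lemma Amphicheiral.exists_perm {x : ι → Space × Space} (hx : x ∈ Config ι)
    (h : Amphicheiral (range fun i => line (x i))) :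
    ∃ (e : Equiv.Perm ι) (c : ι → ℝ), (∀ i, c i ≠ 0) ∧ ∀ i j, i ≠ j →
      SignType.sign (pairDet (x i) (x j)) = -(SignType.sign (c i) * SignType.sign (c j) *
        SignType.sign (pairDet (x (e i)) (x (e j)))) := by
  obtain ⟨M, hM, hiso⟩ := Isotopic.exists_families h (Config.injective hx) rfl
  obtain ⟨y, hy, hyM⟩ := hiso.lift hx.1 fun _ => rfl
  rw [mirrorImage_range] at hM
  simp only [mirrorLine_line] at hM
  obtain ⟨e, he⟩ := exists_equiv_of_range_eq hiso.symm.injective_left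
    (Config.injective (Config.mirror hx)) hM
  choose c d hc hyc using fun i => exists_reparam (x := mirrorData (x (e i)))
    (hy.target_mem.1 i) ((hyM i).trans (congrFun he i).symm)
  refine ⟨e, c, hc, fun i j hij => ?_⟩
  rw [sign_pairDet_eq hy hij, hyc i, hyc j, sign_pairDet_reparam, pairDet_mirrorData,
    Left.sign_neg, mul_neg]

lemma tripleHasLinkingNumber_of_pos {x y z : Space × Space} (hxy : 0 < pairDet x y)
    (hxz : 0 < pairDet x z) (hyz : 0 < pairDet y z) :
    TripleHasLinkingNumber (line x) (line y) (line z) 1 := by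
  intro a u b v c w hu hv hw hx hy hz
  obtain ⟨p, p', hp, h1⟩ := exists_reparam (y := (a, u)) hu hx
  obtain ⟨q, q', hq, h2⟩ := exists_reparam (y := (b, v)) hv hy
  obtain ⟨r, r', hr, h3⟩ := exists_reparam (y := (c, w)) hw hz
  have e1 : linkingNumber a u b v = (SignType.sign (pairDet (a, u) (b, v)) : SignType) := rfl
  have e2 : linkingNumber a u c w = (SignType.sign (pairDet (a, u) (c, w)) : SignType) := rfl
  have e3 : linkingNumber b v c w = (SignType.sign (pairDet (b, v) (c, w)) : SignType) := rfl
  rw [e1, e2, e3, h1, h2, h3, sign_pairDet_reparam, sign_pairDet_reparam, sign_pairDet_reparam,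
    sign_pos hxy, sign_pos hxz, sign_pos hyz]
  rcases hp.lt_or_gt with hp | hp <;> rcases hq.lt_or_gt with hq | hq <;>
    rcases hr.lt_or_gt with hr | hr <;> simp [hp, hq, hr]

/-! ### Generatrices of one hyperboloid -/

lemma pairDet_generatrix_pos {F : Frame} (hF : 0 < F.vol) {θ θ' : Real.Angle} (h : θ ≠ θ') :
    0 < pairDet (F.near (circlePoint 1 ((1 : ℤˣ) : ℤ) θ))
      (F.near (circlePoint 1 ((1 : ℤˣ) : ℤ) θ')) := by
  rw [Frame.pairDet_near_circlePoint]
  have := cos_sin_dist_pos h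
  simpa using mul_pos hF this

lemma generatrix_mem_config {F : Frame} (hF : 0 < F.vol) {p : ℕ} (θ : Fin p ↪ Real.Angle) :
    (fun j => F.near (circlePoint 1 ((1 : ℤˣ) : ℤ) (θ j))) ∈ Config (Fin p) :=
  ⟨fun _ => Frame.near_direction_ne_zero hF _,
    fun _ _ hij => (pairDet_generatrix_pos hF (θ.injective.ne hij)).ne'⟩

lemma exists_isHyperboloidal (p : ℕ) : ∃ S, IsHyperboloidal 1 p S := by
  obtain ⟨g, hg, -⟩ := exists_frameOf_eq (F := (0, EuclideanSpace.single 0 1,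
    EuclideanSpace.single 1 1, EuclideanSpace.single 2 1)) (by simp [Frame.vol, vol_eq])
  have hv : 0 < (frameOf g).vol := by rw [vol_frameOf]; exact hg
  let θ : Fin p ↪ Real.Angle := Fin.valEmbedding.trans (Infinite.natEmbedding _)
  refine ⟨range fun j => (generatrix 1 (θ j)).map (g : Space →ᵃ[ℝ] Space), g, _, hg,
    ⟨θ, rfl⟩, ?_⟩
  simp only [map_generatrix]
  exact isotopic_range (isotopicFamilies_refl (generatrix_mem_config hv θ) fun _ => rfl)

/-- The lines of an interlacing of type `⟨+p⟩` can be oriented so that all linking numbers of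
pairs are positive. -/
lemma IsHyperboloidal.exists_config {p : ℕ} {S : Set (AffineSubspace ℝ Space)}
    (h : IsHyperboloidal 1 p S) : ∃ x ∈ Config (Fin p), (range fun i => line (x i)) = S ∧
      ∀ i j, i ≠ j → 0 < pairDet (x i) (x j) := by
  obtain ⟨g, T, hg, ⟨θ, rfl⟩, hST⟩ := h
  have hv : 0 < (frameOf g).vol := by rw [vol_frameOf]; exact hg
  simp only [map_generatrix] at hST
  have hconf := generatrix_mem_config hv θ
  obtain ⟨M, rfl, hM⟩ := hST.symm.exists_families (Config.injective hconf) rfl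
  obtain ⟨y, hy, hyM⟩ := hM.lift hconf.1 fun _ => rfl
  refine ⟨y, hy.target_mem, by rw [funext hyM], fun i j hij => ?_⟩
  have := sign_pairDet_eq hy hij
  rw [sign_pos (pairDet_generatrix_pos hv (θ.injective.ne hij))] at this
  exact sign_eq_one_iff.1 this.symm

lemma isInterlacing_range {p : ℕ} {x : Fin p → Space × Space} (hx : x ∈ Config (Fin p)) :
    IsInterlacing p (range fun i => line (x i)) := by
  refine (isotopic_range (isotopicFamilies_refl hx fun _ => rfl)).isInterlacing ?_
  rw [← image_univ, (Config.injective hx).encard_image]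
  simp

lemma IsHyperboloidal.not_amphicheiral {p : ℕ} (hp : 3 ≤ p) {S : Set (AffineSubspace ℝ Space)}
    (h : IsHyperboloidal 1 p S) : ¬ Amphicheiral S := by
  obtain ⟨x, hx, rfl, hpos⟩ := h.exists_config
  intro hamp
  obtain ⟨e, c, hc, hsign⟩ := hamp.exists_perm hx
  have key (i j : Fin p) (hij : i ≠ j) : c i * c j < 0 := by
    have := hsign i j hij
    rw [sign_pos (hpos i j hij), sign_pos (hpos _ _ (e.injective.ne hij)), mul_one, ← sign_mul,
      ← Left.sign_neg, eq_comm, sign_eq_one_iff] at this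
    linarith
  -- Among three orientations, two agree.
  have h01 := key ⟨0, by omega⟩ ⟨1, by omega⟩ (by simp)
  have h02 := key ⟨0, by omega⟩ ⟨2, by omega⟩ (by simp)
  have h12 := key ⟨1, by omega⟩ ⟨2, by omega⟩ (by simp)
  have h3 := mul_pos_of_neg_of_neg h01 h02
  nlinarith [sq_nonneg (c ⟨0, by omega⟩)]

/-! ### Interlacings of few lines -/

lemma IsInterlacing.exists_config {p : ℕ} {S : Set (AffineSubspace ℝ Space)}
    (h : IsInterlacing p S) : ∃ x ∈ Config (Fin p), (range fun i => line (x i)) = S := by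
  obtain ⟨hcard, hL, hs⟩ := h
  have : Finite S := finite_of_encard_eq_coe hcard
  have hp : Nat.card S = p := by
    rw [Nat.card_coe_set_eq, ncard, hcard, ENat.toNat_natCast]
  let e : Fin p ≃ S := (Finite.equivFinOfCardEq hp).symm
  obtain ⟨x, hx, hL⟩ := _root_.exists_config (L := fun i => (e i : AffineSubspace ℝ Space))
    (fun i => hL _ (e i).2)
    (fun i j hij => hs (e i).2 (e j).2 fun h => hij (e.injective (Subtype.ext h)))
  refine ⟨x, hx, ?_⟩
  rw [funext hL, show (fun i => (e i : AffineSubspace ℝ Space)) = Subtype.val ∘ e from rfl,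
    EquivLike.range_comp, Subtype.range_coe]

lemma IsInterlacing.amphicheiral_of_le_two {p : ℕ} (hp : p ≤ 2)
    {S : Set (AffineSubspace ℝ Space)} (h : IsInterlacing p S) : Amphicheiral S := by
  obtain ⟨x, hx, rfl⟩ := h.exists_config
  have key : IsotopicFamilies (fun i => line (x i)) fun i => mirrorLine (line (x i)) := by
    rcases hp.lt_or_eq with hp | rfl
    · have : Subsingleton (Fin p) := Fin.subsingleton_iff_le_one.2 (by omega)
      simp only [mirrorLine_line]
      exact isotopicFamilies_of_joinedIn
        (joinedIn_config_of_subsingleton hx (Config.mirror hx))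
    · have hL (i : Fin 2) : IsLine (line (x i)) := isLine_lineThrough _ (hx.1 i)
      have hs : Skew (line (x 0)) (line (x 1)) := Config.skew hx (by decide)
      exact isotopicFamilies_pair hL hs (fun i => (hL i).mirrorLine)
        (hs.mirrorLine (hL 0) (hL 1))
  rw [Amphicheiral, mirrorImage_range]
  exact isotopic_range key

/-! ### The product of the linking numbers of all pairs -/

open Finset in
/-- A product over all pairs does not depend on the order of the factors' indices. -/
lemma prod_Iio_comp_perm {n : ℕ} (f : Fin n → Fin n → ℤ) (hf : ∀ i j, f i j = f j i)
    (e : Equiv.Perm (Fin n)) :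
    ∏ j, ∏ i ∈ Iio j, f (e i) (e j) = ∏ j, ∏ i ∈ Iio j, f i j := by
  -- Both `g` and `g * f` are antisymmetric.
  let g : Fin n → Fin n → ℤ := fun i j => (SignType.sign ((j : ℤ) - (i : ℤ)) : SignType)
  have hg (i j) : g i j = -g j i := by
    simp only [g]
    rw [← neg_sub, Left.sign_neg]
    simp
  have hg1 {i j : Fin n} (h : i < j) : g i j = 1 := by
    have : 0 < (j : ℤ) - (i : ℤ) := by
      have : (i : ℕ) < j := h
      omega
    simp only [g]
    rw [sign_pos this]
    rfl
  have h1 := Equiv.Perm.prod_Iio_comp_eq_sign_mul_prod e hg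
  have h2 := Equiv.Perm.prod_Iio_comp_eq_sign_mul_prod e (f := fun i j => g i j * f i j)
    (fun i j => by rw [hg i j, hf i j, neg_mul])
  have h3 : ∏ j, ∏ i ∈ Iio j, g i j = 1 :=
    prod_eq_one fun j _ => prod_eq_one fun i hi => hg1 (mem_Iio.1 hi)
  have h4 : ∏ j, ∏ i ∈ Iio j, g i j * f i j = ∏ j, ∏ i ∈ Iio j, f i j :=
    prod_congr rfl fun j _ => prod_congr rfl fun i hi => by rw [hg1 (mem_Iio.1 hi), one_mul]
  rw [h3] at h1
  simp only [prod_mul_distrib] at h2 h4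
  rw [h1, h4, mul_one] at h2
  exact mul_left_cancel₀ (by simp) h2

open Finset in
lemma prod_Iio_mul {n : ℕ} (u : Fin n → ℤ) :
    ∏ j, ∏ i ∈ Iio j, u i * u j = ∏ i, u i ^ (n - 1) := by
  have h1 : ∏ j, ∏ i ∈ Iio j, u i = ∏ i, ∏ j ∈ Ioi i, u i :=
    prod_comm' fun i j => by simp
  simp only [prod_mul_distrib]
  rw [h1, ← prod_mul_distrib]
  refine prod_congr rfl fun i _ => ?_
  rw [prod_const, prod_const, ← pow_add, Fin.card_Ioi, Fin.card_Iio]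
  congr 1
  have := i.2
  omega

open Finset in
/-- For an odd number of lines the product of the linking numbers of all pairs does not depend on
the orientations, since every line takes part in an even number of pairs. The number of pairs of
`4 k + 3` lines is odd, so that this product is changed by reflections. -/
lemma not_amphicheiral_of_mod_four {p : ℕ} (hp : p % 4 = 3) {S : Set (AffineSubspace ℝ Space)}
    (h : IsInterlacing p S) : ¬ Amphicheiral S := by
  obtain ⟨x, hx, rfl⟩ := h.exists_config
  intro hamp
  obtain ⟨e, c, hc, hsign⟩ := hamp.exists_perm hx
  let f : Fin p → Fin p → ℤ := fun i j => (SignType.sign (pairDet (x i) (x j)) : SignType)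
  let u : Fin p → ℤ := fun i => (SignType.sign (c i) : SignType)
  have hf (i j) : f i j = f j i := by simp only [f, pairDet_comm]
  have hu (i) : u i ^ (p - 1) = 1 := by
    have h1 : u i ^ 2 = 1 := by
      rcases (hc i).lt_or_gt with h | h <;> simp [u, h]
    rw [show p - 1 = 2 * ((p - 1) / 2) by omega, pow_mul, h1, one_pow]
  have hfe (i j) (hij : i ≠ j) : f i j = -1 * ((u i * u j) * f (e i) (e j)) := by
    simp only [f, u]
    rw [hsign i j hij]
    push_cast
    ring
  have hne : ∏ j, ∏ i ∈ Iio j, f i j ≠ 0 := by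
    refine prod_ne_zero_iff.2 fun j _ => prod_ne_zero_iff.2 fun i hi => ?_
    rcases (hx.2 i j (mem_Iio.1 hi).ne).lt_or_gt with h | h <;> simp [f, h]
  have hprod : ∏ j, ∏ i ∈ Iio j, f i j = -∏ j, ∏ i ∈ Iio j, f i j := by
    calc ∏ j, ∏ i ∈ Iio j, f i j
        = ∏ j, ∏ i ∈ Iio j, (-1 * ((u i * u j) * f (e i) (e j))) :=
          prod_congr rfl fun j _ => prod_congr rfl fun i hi => hfe i j (mem_Iio.1 hi).ne
      _ = (∏ j : Fin p, ∏ i ∈ Iio j, (-1)) * ((∏ j, ∏ i ∈ Iio j, (u i * u j)) *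
            ∏ j, ∏ i ∈ Iio j, f (e i) (e j)) := by
          simp only [← prod_mul_distrib]
      _ = -∏ j, ∏ i ∈ Iio j, f i j := by
          rw [prod_Iio_comp_perm f hf, prod_Iio_mul, prod_congr rfl fun i _ => hu i]
          have hodd : ∏ j : Fin p, ∏ _i ∈ Iio j, (-1 : ℤ) = -1 := by
            simp only [prod_const, Fin.card_Iio, prod_pow_eq_pow_sum]
            refine Odd.neg_one_pow ?_
            rw [Fin.sum_univ_eq_sum_range (fun i => i), sum_range_id]
            obtain ⟨k, rfl⟩ : ∃ k, p = 4 * k + 3 := ⟨p / 4, by omega⟩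
            have : (4 * k + 3) * (4 * k + 3 - 1) / 2 = (4 * k + 3) * (2 * k + 1) := by
              rw [show 4 * k + 3 - 1 = 2 * (2 * k + 1) by omega, mul_left_comm,
                Nat.mul_div_cancel_left _ two_pos]
            rw [this]
            exact Odd.mul ⟨2 * k + 1, by ring⟩ ⟨k, rfl⟩
          rw [hodd, prod_const_one]
          ring
  exact hne (by linarith)

end

theorem mainTheorem5 :
    -- `⟨+p⟩` is nonamphicheiral for `p ≥ 3`, and all its triples have linking number `+1`
    (∀ p : ℕ, 3 ≤ p →
      (∃ S, IsHyperboloidal 1 p S) ∧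
      ∀ S, IsHyperboloidal 1 p S →
        IsInterlacing p S ∧
        (∀ L ∈ S, ∀ M ∈ S, ∀ N ∈ S, L ≠ M → L ≠ N → M ≠ N → TripleHasLinkingNumber L M N 1) ∧
        ¬ Amphicheiral S) ∧
    -- a nonamphicheiral interlacing of `p` lines exists exactly for `p ≥ 3`
    (∀ p : ℕ, (∃ S, IsInterlacing p S ∧ ¬ Amphicheiral S) ↔ 3 ≤ p) ∧
    -- `⟨⟨+p/2⟩, ⟨-p/2⟩⟩` is amphicheiral for even `p`
    (∀ p : ℕ, Even p →
      (∃ S, IsDoubleHyperboloidal (p / 2) S) ∧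
      ∀ S, IsDoubleHyperboloidal (p / 2) S → IsInterlacing p S ∧ Amphicheiral S) ∧
    -- the interlacings of `4k + 1` lines built from the five-line example are amphicheiral
    (∀ (k : ℕ) (δ : ℤˣ),
      (∃ S, IsFiveLineReplacement δ k S) ∧
      ∀ S, IsFiveLineReplacement δ k S → IsInterlacing (4 * k + 1) S ∧ Amphicheiral S) ∧
    -- an amphicheiral interlacing of `p` lines exists exactly for `p ≢ 3 (mod 4)`
    (∀ p : ℕ, (∃ S, IsInterlacing p S ∧ Amphicheiral S) ↔ ¬ p ≡ 3 [MOD 4]) := by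
  have hdouble (p : ℕ) (hp : Even p) (S) (hS : IsDoubleHyperboloidal (p / 2) S) :
      IsInterlacing p S ∧ Amphicheiral S := by
    have := hS.isInterlacing_and_amphicheiral
    rwa [← two_mul, Nat.two_mul_div_two_of_even hp] at this
  have hhyp (p : ℕ) (S) (hS : IsHyperboloidal 1 p S) : IsInterlacing p S := by
    obtain ⟨x, hx, rfl, -⟩ := hS.exists_config
    exact isInterlacing_range hx
  refine ⟨fun p hp => ⟨exists_isHyperboloidal p, fun S hS => ⟨hhyp p S hS, ?_,
    hS.not_amphicheiral hp⟩⟩, fun p => ⟨?_, fun hp => ?_⟩,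
    fun p hp => ⟨exists_isDoubleHyperboloidal _, hdouble p hp⟩,
    fun k δ => ⟨exists_isFiveLineReplacement δ k,
      fun S hS => hS.isInterlacing_and_amphicheiral⟩, fun p => ⟨?_, fun hp => ?_⟩⟩
  · obtain ⟨x, hx, rfl, hpos⟩ := hS.exists_config
    rintro _ ⟨i, rfl⟩ _ ⟨j, rfl⟩ _ ⟨k, rfl⟩ hij hik hjk
    exact tripleHasLinkingNumber_of_pos (hpos i j fun h => hij (by rw [h]))
      (hpos i k fun h => hik (by rw [h])) (hpos j k fun h => hjk (by rw [h]))
  · rintro ⟨S, hS, hna⟩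
    by_contra! hp
    exact hna (hS.amphicheiral_of_le_two (by omega))
  · obtain ⟨S, hS⟩ := exists_isHyperboloidal p
    exact ⟨S, hhyp p S hS, hS.not_amphicheiral hp⟩
  · rintro ⟨S, hS, hamp⟩ hp
    exact not_amphicheiral_of_mod_four hp hS hamp
  · by_cases hev : Even p
    · obtain ⟨S, hS⟩ := exists_isDoubleHyperboloidal (p / 2)
      exact ⟨S, hdouble p hev S hS⟩
    · obtain ⟨k, rfl⟩ : ∃ k, p = 4 * k + 1 := by
        refine ⟨p / 4, ?_⟩
        rw [Nat.not_even_iff] at hev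
        have : p % 4 ≠ 3 := hp
        omega
      obtain ⟨S, hS⟩ := exists_isFiveLineReplacement 1 k
      exact ⟨S, hS.isInterlacing_and_amphicheiral⟩
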